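/- Let $n,k\in\mathbb N$, $\varepsilon\in(0,1]$, and let $Q$ be a known probability distribution on $[n]$. An instance of the 2-clustering problem with one known distribution consists of distributions $D_1,\dots,D_k$ on $[n]$ and a hidden set $\mathcal I\subseteq[k]$ of size $r=|\mathcal I|\in[1,k-1]$ such that $D_b=Q$ for all $b\notin\mathcal I$, all $D_a$ with $a\in\mathcal I$ are equal to one unknown distribution $P$, and $d_{\mathrm{TV}}(P,Q)=\frac12\sum_{x\in[n]}|P(x)-Q(x)|\ge\varepsilon$. A randomized algorithm has adaptive sample access to $D_1,\dots,D_k$ and succeeds if it outputs $\mathcal I$ (and hence the partition $\{\mathcal I,[k]\setminus\mathcal I\}$). The two-stage algorithm works as follows. In Stage 1 it chooses $\min(k,\lceil 9k/r\rceil)$ of the $k$ distributions uniformly at random, tests each of them for being equal to $Q$ with a test that samples only from the distribution tested, and takes the first one that the test declares different from $Q$ as an exemplar of $P$. In Stage 2 it classifies all of $D_1,\dots,D_k$ by a procedure that is given this exemplar and sample access to $D_1,\dots,D_k$. If $r$ is not given, Stage 1 instead proceeds in rounds $i=1,2,\dots$, where round $i$ tests $2^i$ further distributions (or all remaining ones,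 if these are fewer), chosen uniformly at random among those not tested so far, until a round contains a distribution declared different from $Q$. **Theorem C.1.** There are a choice of the tests, depending only on $(n,k,r,\varepsilon,Q)$ (for unknown $r$: only on $(n,k,\varepsilon,Q)$ and the round), and a choice of the Stage 2 procedure, depending only on $(n,k,\varepsilon,Q)$, such that the following holds. For every constant $c>0$ there is a constant $C>0$, depending only on $c$, such that, with the bound $$N\le C\left(\frac{k\log(k)\sqrt n}{r\varepsilon^2}+\frac{\sqrt{nk\log (k)}}{\varepsilon^2}\right)\ \text{ if } n\ge c\,k\log (k),\qquad N\le C\left(\frac{k\log(k)\sqrt n}{r\varepsilon^2}+\frac{k\log (k)}{\varepsilon^2}\right)\ \text{ if } n\le c\,k\log (k) \tag{$*$}$$ on the total number $N$ of samples drawn: 1. If $r$ is given, the algorithm outputs $\mathcal I$ with probability at least $2/3$ on every instance, and $N$ always satisfies $(*)$. 2. If $r$ is not given, then on every instance, with probability at least $2/3$, the algorithm outputs $\mathcal I$ and $N$ satisfies $(*)$. -/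

import Mathlib

namespace Clustering

/-- A randomized, adaptive sampling procedure with result in `α`. It has sample access to a
family of unknown distributions on `Fin n` indexed by `ι` (the arms). At each point it either stops
with a result, or draws one fresh sample from an arm of its choice, or uses internal randomness
with a distribution of its choice; what it does next may depend on everything seen so far. -/
inductive Proc (ι : Type) (n : ℕ) (α : Type) : Type 1
  | ret (a : α) : Proc ι n α
  | sample (i : ι) (next : Fin n → Proc ι n α) : Proc ι n α
  | random {Ω : Type} (p : PMF Ω) (next : Ω → Proc ι n α) : Proc ι n α

namespace Proc

variable {ι κ : Type} {n : ℕ} {α β : Type}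

/-- Run a procedure, then continue with a procedure that depends on its result. -/
def bind : Proc ι n α → (α → Proc ι n β) → Proc ι n β
  | ret a, f => f a
  | sample i next, f => sample i fun x => (next x).bind f
  | random p next, f => random p fun w => (next w).bind f

/-- The same procedure, with every access to arm `i` replaced by an access to arm `f i`. -/
def onArms (f : ι → κ) : Proc ι n α → Proc κ n α
  | ret a => ret a
  | sample i next => sample (f i) fun x => (next x).onArms f
  | random p next => random p fun w => (next w).onArms f

/-- The joint law of the result and of the number of samples drawn, when arm `i` has
distribution `D i` and all samples are independent. -/
noncomputable def run (D : ι → PMF (Fin n)) : Proc ι n α → PMF (α × ℕ)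
  | ret a => PMF.pure (a, 0)
  | sample i next => (D i).bind fun x => ((next x).run D).map fun o => (o.1, o.2 + 1)
  | random p next => p.bind fun w => (next w).run D

end Proc

/-- Total variation distance of two distributions on `Fin n`. -/
noncomputable def tvDist {n : ℕ} (P Q : PMF (Fin n)) : ℝ :=
  (1 / 2) * ∑ x, |(P x).toReal - (Q x).toReal|

/-- The promise of the 2-clustering problem with known distribution `Q`: the distributions
`D i` with `i ∉ I` are all equal to `Q`, those with `i ∈ I` are all equal to each other, the two
are `ε`-far in total variation distance, and both clusters are non-empty. -/
structure IsInstance {n k : ℕ} (Q : PMF (Fin n)) (ε : ℝ) (D : Fin k → PMF (Fin n))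
    (I : Finset (Fin k)) : Prop where
  known : ∀ b, b ∉ I → D b = Q
  same : ∀ a ∈ I, ∀ b ∈ I, D a = D b
  far : ∀ a ∈ I, ∀ b, b ∉ I → ε ≤ tvDist (D a) (D b)
  nonempty : I.Nonempty
  nonempty_compl : Iᶜ.Nonempty

/-- A uniformly random subset of `R` of size `m` (all of `R` if `R` has fewer elements). -/
noncomputable def uniformSubset {k : ℕ} (m : ℕ) (R : Finset (Fin k)) : PMF (Finset (Fin k)) :=
  PMF.uniformOfFinset (R.powersetCard (min m R.card))
    (Finset.powersetCard_nonempty.2 (min_le_right m R.card))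

/-- Apply a test of a single distribution to every arm in a list; the result is the list of arms
for which the test answered `true`. -/
def testAll {k n : ℕ} (tester : Proc Unit n Bool) : List (Fin k) → Proc (Fin k) n (List (Fin k))
  | [] => .ret []
  | i :: L => (tester.onArms fun _ => i).bind fun b =>
      (testAll tester L).bind fun F => .ret (if b then i :: F else F)

/-- Stage 1. In a round `(m, tester)`, choose uniformly at random `m` of the arms of `R`, the arms
not examined so far, and apply `tester` to each of them. If it accepts some arm, return the first
such arm; otherwise go on to the next round. -/
noncomputable def findOne {k n : ℕ} :
    List (ℕ × Proc Unit n Bool) → Finset (Fin k) → Proc (Fin k) n (Option (Fin k))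
  | [], _ => .ret none
  | (m, tester) :: rounds, R =>
      .random (uniformSubset m R) fun S =>
        (testAll tester (S.sort (· ≤ ·))).bind fun F =>
          match F with
          | [] => findOne rounds (R \ S)
          | i :: _ => .ret (some i)

/-- The two-stage algorithm: Stage 1 looks for one arm whose distribution is not the known one;
Stage 2 uses this arm as an exemplar of the unknown distribution and classifies all arms.
The result is the set of arms declared to have the unknown distribution. -/
noncomputable def twoStage {k n : ℕ} (rounds : List (ℕ × Proc Unit n Bool))
    (classify : Fin k → Proc (Fin k) n (Finset (Fin k))) : Proc (Fin k) n (Finset (Fin k)) :=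
  (findOne rounds Finset.univ).bind fun found =>
    match found with
    | none => .ret ∅
    | some i => classify i

/-- Stage 1 for known size `r` of the unknown cluster: one round, with `⌈9k/r⌉` arms. -/
noncomputable def roundsKnownSize {n : ℕ} (k r : ℕ) (tester : Proc Unit n Bool) :
    List (ℕ × Proc Unit n Bool) :=
  [(⌈(9 * k : ℝ) / r⌉₊, tester)]

/-- Stage 1 for unknown size of the unknown cluster: round `i = 1, 2, …` examines `2 ^ i` further
arms (after `k` rounds all `k` arms have been examined). -/
def roundsUnknownSize {n : ℕ} (k : ℕ) (tester : ℕ → Proc Unit n Bool) :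
    List (ℕ × Proc Unit n Bool) :=
  (List.range k).map fun i => (2 ^ (i + 1), tester (i + 1))

/-- `N` samples are within the claimed sample complexity, where `c` is the constant in the
conditions `n ≳ k log k` and `n ≲ k log k`, and `C` is the constant in `O(·)`. -/
def WithinBudget (c C : ℝ) (n k r : ℕ) (ε : ℝ) (N : ℕ) : Prop :=
  (c * (k * Real.log k) ≤ n →
    (N : ℝ) ≤ C * (k * Real.log k * √n / (r * ε ^ 2) + √(n * k * Real.log k) / ε ^ 2)) ∧
  ((n : ℝ) ≤ c * (k * Real.log k) →
    (N : ℝ) ≤ C * (k * Real.log k * √n / (r * ε ^ 2) + k * Real.log k / ε ^ 2))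

end Clustering

open Clustering

/-!
Both stages compare an unknown distribution `P` with `Q` by means of a learned function. Some first
samples from `P` give weights `w ≥ Q` that also dominate, in a weak average sense, the distribution
`P` itself. Further samples, with empirical distribution `E`, give `f = (E - Q) / w`. If `P`
is `ε`-far from `Q`, then the means of `f` under `P` and `Q` differ by at least a constant times
`ε ^ 2`, and the second moments of `f` are small compared with the square of this gap; if `P = Q`,
there is no gap and the second moment is tiny. In both cases Chebyshev's inequality lets `m` fresh
samples decide the question by a threshold for the empirical mean of `f`, provided that `f` was
learned from `M ≥ m` samples with `M m ≳ n / ε ^ 4` and `m ≳ 1 / ε ^ 2`.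

Stage 1 uses `M = m ≈ √n / ε ^ 2` for each test. Stage 2 learns `f` only once, from the exemplar, so
it can balance one large `M` against a small `m` that is paid for each of the `k` arms. Majority
votes of `O(log k)` tests bring the error probability down to where a union bound over all arms
works. A random set of `9k / r` arms misses the hidden set with probability at most `exp (-9)`, and
for unknown `r` the first round of doubling size at least `9k / r` costs only a constant factor
more.
-/

namespace Clustering

open Finset MeasureTheory ProbabilityTheory
open scoped ENNReal NNReal

section HoldsExcept

variable {α β : Type*} {μ : PMF α} {p q : α → Prop} {δ δ' : ℝ≥0}

/-- The event `p` has probability at least `1 - δ` under `μ`, phrased as a bound on the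
probability of its complement so that failure probabilities add up. -/
def HoldsExcept (μ : PMF α) (p : α → Prop) (δ : ℝ≥0) : Prop :=
  μ.toOuterMeasure {a | ¬ p a} ≤ δ

theorem holdsExcept_zero_iff : HoldsExcept μ p 0 ↔ ∀ a ∈ μ.support, p a := by
  rw [HoldsExcept, ENNReal.coe_zero, nonpos_iff_eq_zero, PMF.toOuterMeasure_apply_eq_zero_iff,
    Set.disjoint_left]
  simp only [Set.mem_ofPred_eq, not_not]

theorem holdsExcept_one (μ : PMF α) (p : α → Prop) : HoldsExcept μ p 1 := by
  rw [HoldsExcept, ENNReal.coe_one,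
    ← (μ.toOuterMeasure_apply_eq_one_iff Set.univ).2 (Set.subset_univ _)]
  exact measure_mono (Set.subset_univ _)

theorem HoldsExcept.mono (h : HoldsExcept μ p δ) (hpq : ∀ a ∈ μ.support, p a → q a)
    (hδ : δ ≤ δ') : HoldsExcept μ q δ' :=
  calc μ.toOuterMeasure {a | ¬ q a}
    _ ≤ μ.toOuterMeasure {a | ¬ p a} :=
        μ.toOuterMeasure_mono fun a ha hp => ha.1 (hpq a ha.2 hp)
    _ ≤ δ' := h.trans (by exact_mod_cast hδ)

theorem HoldsExcept.imp (h : HoldsExcept μ p δ) (hpq : ∀ a, p a → q a) : HoldsExcept μ q δ :=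
  h.mono (fun a _ => hpq a) le_rfl

theorem HoldsExcept.and (hp : HoldsExcept μ p δ) (hq : HoldsExcept μ q δ') :
    HoldsExcept μ (fun a => p a ∧ q a) (δ + δ') := by
  rw [HoldsExcept, ENNReal.coe_add]
  refine le_trans (measure_mono fun a ha => ?_) ((measure_union_le _ _).trans (add_le_add hp hq))
  exact not_and_or.1 ha

theorem holdsExcept_map_iff {f : α → β} {p : β → Prop} :
    HoldsExcept (μ.map f) p δ ↔ HoldsExcept μ (fun a => p (f a)) δ := by
  rw [HoldsExcept, PMF.toOuterMeasure_map_apply]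
  rfl

theorem HoldsExcept.bind_add_mul {g : α → PMF β} {q : β → Prop} {δ'' : ℝ≥0}
    (hp : HoldsExcept μ p δ) (hg : ∀ a ∈ μ.support, p a → HoldsExcept (g a) q δ')
    (hg' : ∀ a, ¬ p a → HoldsExcept (g a) q δ'') :
    HoldsExcept (μ.bind g) q (δ' + δ * δ'') := by
  rw [HoldsExcept, PMF.toOuterMeasure_bind_apply]
  calc ∑' a, μ a * (g a).toOuterMeasure {b | ¬ q b}
    _ ≤ ∑' a, (μ a * δ' + {a | ¬ p a}.indicator μ a * δ'') := by
        refine ENNReal.tsum_le_tsum fun a => ?_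
        by_cases ha : p a
        · by_cases h0 : a ∈ μ.support
          · exact (mul_le_mul_right (hg a h0 ha) _).trans le_self_add
          · simp [(PMF.apply_eq_zero_iff _ _).2 h0]
        · rw [Set.indicator_of_mem (by exact ha)]
          exact (mul_le_mul_right (hg' a ha) _).trans le_add_self
    _ = δ' + μ.toOuterMeasure {a | ¬ p a} * δ'' := by
        rw [ENNReal.tsum_add, ENNReal.tsum_mul_right, ENNReal.tsum_mul_right, μ.tsum_coe, one_mul,
          PMF.toOuterMeasure_apply]
    _ ≤ (δ' + δ * δ'' : ℝ≥0) := by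
        push_cast
        gcongr
        exact hp

theorem HoldsExcept.bind {g : α → PMF β} {q : β → Prop} (hp : HoldsExcept μ p δ)
    (hg : ∀ a ∈ μ.support, p a → HoldsExcept (g a) q δ') :
    HoldsExcept (μ.bind g) q (δ + δ') := by
  simpa only [mul_one, add_comm] using hp.bind_add_mul hg fun a _ => holdsExcept_one _ _

theorem HoldsExcept.le_toOuterMeasure (h : HoldsExcept μ p δ) :
    1 - (δ : ℝ≥0∞) ≤ μ.toOuterMeasure {a | p a} := by
  rw [tsub_le_iff_right]
  calc (1 : ℝ≥0∞) = μ.toOuterMeasure ({a | p a} ∪ {a | ¬ p a}) := by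
        rw [eq_comm, PMF.toOuterMeasure_apply_eq_one_iff]
        exact fun a _ => em (p a)
    _ ≤ μ.toOuterMeasure {a | p a} + δ := (measure_union_le _ _).trans (by gcongr; exact h)

theorem HoldsExcept.two_thirds_le (h : HoldsExcept μ p (1 / 3)) :
    2 / 3 ≤ μ.toOuterMeasure {a | p a} := by
  refine le_trans (ENNReal.le_sub_of_add_le_right ENNReal.coe_ne_top ?_) h.le_toOuterMeasure
  have hsum : (2 / 3 + 1 / 3 : ℝ≥0) = 1 := by norm_num [← NNReal.coe_inj]
  have hcoe : (2 / 3 : ℝ≥0∞) = ((2 / 3 : ℝ≥0) : ℝ≥0∞) := by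
    rw [ENNReal.coe_div three_ne_zero, ENNReal.coe_ofNat, ENNReal.coe_ofNat]
  rw [hcoe, ← ENNReal.coe_add, hsum, ENNReal.coe_one]

theorem holdsExcept_lt_of_integral_le [Finite α] [MeasurableSpace α] [MeasurableSingletonClass α]
    {F : α → ℝ} {t : ℝ} (hF : 0 ≤ F) (ht : 0 < t) (h : ∫ a, F a ∂μ.toMeasure ≤ δ * t) :
    HoldsExcept μ (fun a => F a < t) δ := by
  have hmarkov := mul_meas_ge_le_integral_of_nonneg (μ := μ.toMeasure)
    (Filter.Eventually.of_forall hF) (.of_finite) t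
  have hreal : μ.toMeasure.real {a | t ≤ F a} ≤ δ := by
    refine le_of_mul_le_mul_left ?_ ht
    linarith
  simp only [HoldsExcept, not_lt]
  rw [← PMF.toMeasure_apply_eq_toOuterMeasure]
  exact (ENNReal.toReal_le_toReal (measure_ne_top _ _) ENNReal.coe_ne_top).1 hreal

end HoldsExcept

namespace Proc

variable {ι κ : Type} {n : ℕ} {α β : Type}

theorem run_bind (D : ι → PMF (Fin n)) (P : Proc ι n α) (f : α → Proc ι n β) :
    (P.bind f).run D =
      (P.run D).bind fun o => ((f o.1).run D).map fun o' => (o'.1, o.2 + o'.2) := by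
  induction P with
  | ret a =>
    simp only [Proc.bind, run, PMF.pure_bind, zero_add]
    exact (PMF.map_id _).symm
  | sample i next ih =>
    simp only [Proc.bind, run, ih, PMF.map_bind, PMF.bind_bind, PMF.bind_map, PMF.map_comp,
      Function.comp_def, add_right_comm]
  | random p next ih => simp only [Proc.bind, run, ih, PMF.bind_bind]

theorem run_onArms (D : κ → PMF (Fin n)) (f : ι → κ) (P : Proc ι n α) :
    (P.onArms f).run D = P.run (D ∘ f) := by
  induction P with
  | ret a => rfl
  | sample i next ih => simp only [onArms, run, ih, Function.comp_apply]
  | random p next ih => simp only [onArms, run, ih]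

/-- The law of the result of a procedure, without the number of samples drawn. -/
noncomputable def law (D : ι → PMF (Fin n)) (P : Proc ι n α) : PMF α := (P.run D).map Prod.fst

variable {D : ι → PMF (Fin n)}

theorem law_ret (a : α) : (ret a : Proc ι n α).law D = PMF.pure a := by
  simp only [law, run, PMF.pure_map]

theorem law_sample (i : ι) (next : Fin n → Proc ι n α) :
    (sample i next).law D = (D i).bind fun x => (next x).law D := by
  simp only [law, run, PMF.map_bind, PMF.map_comp]
  rfl

theorem law_bind (P : Proc ι n α) (f : α → Proc ι n β) :
    (P.bind f).law D = (P.law D).bind fun a => (f a).law D := by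
  simp only [law, run_bind, PMF.map_bind, PMF.bind_map, PMF.map_comp]
  rfl

theorem law_bind_ret (P : Proc ι n α) (f : α → β) :
    (P.bind fun a => ret (f a)).law D = (P.law D).map f := by
  simp only [law_bind, law_ret]
  rfl

theorem law_onArms {D : κ → PMF (Fin n)} (f : ι → κ) (P : Proc ι n α) :
    (P.onArms f).law D = P.law (D ∘ f) := by
  simp only [law, run_onArms]

/-- The procedure never draws more than `b` samples. -/
def CostLE (P : Proc ι n α) (b : ℕ) : Prop :=
  ∀ D : ι → PMF (Fin n), ∀ o ∈ (P.run D).support, o.2 ≤ b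

theorem CostLE.mono {P : Proc ι n α} {b b' : ℕ} (h : P.CostLE b) (hb : b ≤ b') : P.CostLE b' :=
  fun D o ho => (h D o ho).trans hb

theorem costLE_ret (a : α) : (ret a : Proc ι n α).CostLE 0 := by
  intro D o ho
  rw [run, PMF.mem_support_pure_iff] at ho
  rw [ho]

theorem CostLE.sample {i : ι} {next : Fin n → Proc ι n α} {b : ℕ} (h : ∀ x, (next x).CostLE b) :
    (sample i next).CostLE (b + 1) := by
  intro D o ho
  simp only [run, PMF.mem_support_bind_iff, PMF.mem_support_map_iff] at ho
  obtain ⟨x, -, o', ho', rfl⟩ := ho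
  exact Nat.succ_le_succ (h x D o' ho')

theorem CostLE.random {Ω : Type} {μ : PMF Ω} {next : Ω → Proc ι n α} {b : ℕ}
    (h : ∀ w ∈ μ.support, (next w).CostLE b) : (random μ next).CostLE b := by
  intro D o ho
  rw [run, PMF.mem_support_bind_iff] at ho
  obtain ⟨w, hw, ho⟩ := ho
  exact h w hw D o ho

theorem CostLE.bind {P : Proc ι n α} {f : α → Proc ι n β} {b b' : ℕ} (h : P.CostLE b)
    (hf : ∀ a, (f a).CostLE b') : (P.bind f).CostLE (b + b') := by
  intro D o ho
  simp only [run_bind, PMF.mem_support_bind_iff, PMF.mem_support_map_iff] at ho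
  obtain ⟨o₁, h₁, o₂, h₂, rfl⟩ := ho
  exact Nat.add_le_add (h D o₁ h₁) (hf _ D o₂ h₂)

theorem CostLE.bind_ret {P : Proc ι n α} {b : ℕ} (h : P.CostLE b) (f : α → β) :
    (P.bind fun a => ret (f a)).CostLE b :=
  h.bind fun _ => costLE_ret _

theorem CostLE.onArms {P : Proc ι n α} {b : ℕ} (h : P.CostLE b) (f : ι → κ) :
    (P.onArms f).CostLE b := by
  intro D o ho
  rw [run_onArms] at ho
  exact h _ o ho

/-- Independent repetitions of a procedure; the result is the vector of their results. -/
def replicate (P : Proc ι n α) : (L : ℕ) → Proc ι n (Fin L → α)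
  | 0 => ret Fin.elim0
  | L + 1 => P.bind fun a => (P.replicate L).bind fun v => ret (Fin.cons a v)

theorem CostLE.replicate {P : Proc ι n α} {b : ℕ} (h : P.CostLE b) :
    ∀ L, (P.replicate L).CostLE (L * b)
  | 0 => (costLE_ret _).mono (Nat.zero_le _)
  | L + 1 => (h.bind fun a => (h.replicate L).bind_ret _).mono (by rw [add_one_mul, add_comm])

theorem law_replicate_apply (P : Proc ι n α) :
    ∀ (L : ℕ) (v : Fin L → α), (P.replicate L).law D v = ∏ i, P.law D (v i)
  | 0, v => by
    rw [replicate, law_ret, Subsingleton.elim v Fin.elim0, PMF.pure_apply_self, Fin.prod_univ_zero]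
  | L + 1, v => by
    classical
    have hcons (a : α) : (((P.replicate L).law D).map (Fin.cons a)) v =
        if a = v 0 then (P.replicate L).law D (Fin.tail v) else 0 := by
      have hv (w : Fin L → α) : v = Fin.cons a w ↔ a = v 0 ∧ w = Fin.tail v := by
        rw [← Fin.cons_self_tail v, Fin.cons_inj, Fin.cons_zero, Fin.tail_cons, eq_comm (a := a),
          eq_comm (a := w)]
      simp only [PMF.map_apply, hv, ite_and]
      split_ifs
      · exact tsum_ite_eq (Fin.tail v) _
      · exact tsum_zero
    rw [replicate, law_bind, PMF.bind_apply, Fin.prod_univ_succ, ← law_replicate_apply P L]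
    simp only [law_bind_ret, hcons, mul_ite, mul_zero]
    exact tsum_ite_eq (v 0) _

theorem toMeasure_law_replicate [Countable α] [MeasurableSpace α] [MeasurableSingletonClass α]
    (P : Proc ι n α) (L : ℕ) :
    ((P.replicate L).law D).toMeasure = Measure.pi fun _ => (P.law D).toMeasure := by
  refine Measure.ext_of_singleton fun v => ?_
  rw [PMF.toMeasure_apply_singleton _ _ (measurableSet_singleton v), Measure.pi_singleton,
    law_replicate_apply]
  simp only [PMF.toMeasure_apply_singleton _ _ (measurableSet_singleton _)]

end Proc

section Samples

variable {α : Type*} {M : ℕ}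

/-- The average of `g` over a vector of samples. -/
noncomputable def empiricalMean (g : α → ℝ) (ω : Fin M → α) : ℝ := (∑ i, g (ω i)) / M

/-- The number of times that `x` occurs in a vector of samples. -/
def occurrences [DecidableEq α] (ω : Fin M → α) (x : α) : ℕ := #{i | ω i = x}

theorem sum_comp_eq_sum_occurrences_mul [Fintype α] [DecidableEq α] (g : α → ℝ) (ω : Fin M → α) :
    ∑ i, g (ω i) = ∑ x, occurrences ω x * g x := by
  rw [← sum_fiberwise' univ ω g]
  simp only [sum_const, nsmul_eq_mul, occurrences]

theorem empiricalMean_single [DecidableEq α] (ω : Fin M → α) (x : α) :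
    empiricalMean (Pi.single x 1) ω = occurrences ω x / M := by
  simp only [empiricalMean, occurrences, Pi.single_apply, sum_boole]

theorem occurrences_removeNth [DecidableEq α] (ω : Fin (M + 1) → α) (x : α) (i : Fin (M + 1)) :
    occurrences ω x = (if ω i = x then 1 else 0) + occurrences (i.removeNth ω) x := by
  rw [occurrences, occurrences, card_filter, card_filter, i.sum_univ_succAbove]
  rfl

variable [MeasurableSpace α] {ν : Measure α} [IsProbabilityMeasure ν]

theorem integral_empiricalMean {g : α → ℝ} (hg : Integrable g ν) (hM : 0 < M) :
    ∫ ω, empiricalMean g ω ∂Measure.pi (fun _ : Fin M => ν) = ∫ x, g x ∂ν := by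
  simp only [empiricalMean]
  rw [integral_div, integral_finsetSum _ fun i _ => integrable_comp_eval hg]
  simp only [fun i => integral_comp_eval (μ := fun _ : Fin M => ν) (i := i)
    hg.aestronglyMeasurable, sum_const, card_univ, Fintype.card_fin,
    nsmul_eq_mul]
  exact mul_div_cancel_left₀ _ (by positivity)

theorem integral_empiricalMean_sub_sq_le {g : α → ℝ} (hg : MemLp g 2 ν) (hM : 0 < M) (c : ℝ) :
    ∫ ω, (empiricalMean g ω - c) ^ 2 ∂Measure.pi (fun _ : Fin M => ν) ≤
      (∫ x, g x ^ 2 ∂ν) / M + (∫ x, g x ∂ν - c) ^ 2 := by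
  set π := Measure.pi fun _ : Fin M => ν
  have hsum : MemLp (fun ω : Fin M → α => ∑ i, g (ω i)) 2 π :=
    memLp_finsetSum _ fun i _ => hg.comp_measurePreserving (measurePreserving_eval _ i)
  have hmean : MemLp (fun ω : Fin M → α => empiricalMean g ω) 2 π := by
    simpa only [empiricalMean, div_eq_mul_inv] using hsum.mul_const _
  have hvar : Var[fun ω : Fin M → α => empiricalMean g ω; π] ≤ (∫ x, g x ^ 2 ∂ν) / M :=
    calc Var[fun ω : Fin M → α => empiricalMean g ω; π]
      _ = (∑ _i : Fin M, Var[g; ν]) * (M : ℝ)⁻¹ ^ 2 := by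
          rw [← variance_sum_pi fun _ => hg, ← variance_mul_const]
          congr 1
          funext ω
          rw [empiricalMean, div_eq_mul_inv, Finset.sum_apply]
      _ = Var[g; ν] / M := by
          rw [sum_const, card_univ, Fintype.card_fin, nsmul_eq_mul]
          field_simp
      _ ≤ (∫ x, g x ^ 2 ∂ν) / M := by
          gcongr
          exact variance_le_expectation_sq hg.aestronglyMeasurable
  have hbias := variance_eq_sub (hmean.sub (memLp_const c))
  have hshift := variance_sub_const hmean.aestronglyMeasurable c
  simp only [Pi.sub_def, Pi.pow_def] at hbias
  rw [integral_sub (hmean.integrable one_le_two) (integrable_const c),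
    integral_empiricalMean (hg.integrable one_le_two) hM, integral_const, probReal_univ,
    one_smul] at hbias
  linarith

end Samples

section SizeBias

variable {α : Type*} {M : ℕ} [Finite α] [DecidableEq α] [MeasurableSpace α]
  [MeasurableSingletonClass α] {ν : Measure α} [IsProbabilityMeasure ν]

theorem integral_occurrences_mul (φ : ℕ → ℝ) (x : α) :
    ∫ ω, occurrences ω x * φ (occurrences ω x) ∂Measure.pi (fun _ : Fin (M + 1) => ν) =
      (M + 1) * ν.real {x} *
        ∫ ω, φ (occurrences ω x + 1) ∂Measure.pi (fun _ : Fin M => ν) := by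
  have hcoord (i : Fin (M + 1)) :
      ∫ ω, (if ω i = x then 1 else 0) * φ (occurrences ω x) ∂Measure.pi (fun _ => ν) =
        ν.real {x} * ∫ ω, φ (occurrences ω x + 1) ∂Measure.pi (fun _ : Fin M => ν) := by
    have hsplit (ω : Fin (M + 1) → α) :
        (if ω i = x then 1 else 0) * φ (occurrences ω x) =
          (if ω i = x then 1 else 0) * φ (occurrences (i.removeNth ω) x + 1) := by
      rw [occurrences_removeNth ω x i]
      split_ifs
      · rw [add_comm]
      · simp only [zero_mul]
    have hfirst : ∫ y, (if y = x then 1 else 0) ∂ν = ν.real {x} := by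
      rw [← integral_indicator_one (measurableSet_singleton x)]
      simp only [Set.indicator_apply, Set.mem_singleton_iff, Pi.one_apply]
    simp only [hsplit]
    rw [← hfirst, ← integral_prod_mul]
    exact (measurePreserving_piFinSuccAbove (fun _ => ν) i).integral_comp'
      fun z : α × (Fin M → α) => (if z.1 = x then 1 else 0) * φ (occurrences z.2 x + 1)
  have hsum (ω : Fin (M + 1) → α) : (occurrences ω x : ℝ) * φ (occurrences ω x) =
      ∑ i, (if ω i = x then 1 else 0) * φ (occurrences ω x) := by
    rw [← sum_mul, sum_boole, occurrences]
  simp only [hsum]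
  rw [integral_finsetSum _ fun i _ => .of_finite]
  simp only [hcoord, sum_const, card_univ, Fintype.card_fin, nsmul_eq_mul]
  push_cast
  ring

theorem mul_integral_inv_occurrences_le (x : α) :
    (M + 1) * ν.real {x} *
      ∫ ω, ((occurrences ω x : ℝ) + 1)⁻¹ ∂Measure.pi (fun _ : Fin M => ν) ≤ 1 := by
  have hbias := integral_occurrences_mul (M := M) (ν := ν) (fun N => (N : ℝ)⁻¹) x
  push_cast at hbias
  rw [← hbias]
  calc ∫ ω, (occurrences ω x : ℝ) * (occurrences ω x : ℝ)⁻¹ ∂Measure.pi (fun _ => ν)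
    _ ≤ ∫ _, (1 : ℝ) ∂Measure.pi (fun _ : Fin (M + 1) => ν) :=
        integral_mono .of_finite .of_finite fun ω => mul_inv_le_one
    _ = 1 := by rw [integral_const, probReal_univ, one_smul]

theorem sq_mul_integral_inv_occurrences_sq_le (x : α) :
    (M * ν.real {x}) ^ 2 *
      ∫ ω, (((occurrences ω x : ℝ) + 1) ^ 2)⁻¹ ∂Measure.pi (fun _ : Fin M => ν) ≤ 2 := by
  set p := ν.real {x}
  have : 0 ≤ p := measureReal_nonneg
  have hbias := integral_occurrences_mul (M := M) (ν := ν)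
    (fun N => ((N : ℝ) * (N + 1))⁻¹) x
  push_cast at hbias
  set J := ∫ ω, (((occurrences ω x : ℝ) + 1) * ((occurrences ω x : ℝ) + 1 + 1))⁻¹
    ∂Measure.pi (fun _ : Fin M => ν)
  have : 0 ≤ J := integral_nonneg fun ω => by positivity
  have hsq : ∫ ω, (((occurrences ω x : ℝ) + 1) ^ 2)⁻¹ ∂Measure.pi (fun _ : Fin M => ν) ≤
      2 * J := by
    rw [← integral_const_mul]
    refine integral_mono .of_finite .of_finite fun ω => ?_
    simp only [inv_eq_one_div]
    rw [mul_one_div, div_le_div_iff₀ (by positivity) (by positivity)]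
    nlinarith [Nat.cast_nonneg (α := ℝ) (occurrences ω x)]
  have hlower : (M + 1) * p * J ≤
      ∫ ω, ((occurrences ω x : ℝ) + 1)⁻¹ ∂Measure.pi (fun _ : Fin (M + 1) => ν) := by
    rw [← hbias]
    refine integral_mono .of_finite .of_finite fun ω => ?_
    rw [mul_inv, ← mul_assoc]
    exact mul_le_of_le_one_left (by positivity) mul_inv_le_one
  have hupper := mul_integral_inv_occurrences_le (M := M + 1) (ν := ν) x
  push_cast at hupper
  calc (M * p) ^ 2 * ∫ ω, (((occurrences ω x : ℝ) + 1) ^ 2)⁻¹ ∂Measure.pi (fun _ : Fin M => ν)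
    _ ≤ (M * p) ^ 2 * (2 * J) := by gcongr
    _ = 2 * (M * p * (M * p * J)) := by ring
    _ ≤ 2 * ((M + 1 + 1) * p * ((M + 1) * p * J)) := by gcongr <;> linarith
    _ ≤ 2 * 1 := by
        gcongr
        exact (mul_le_mul_of_nonneg_left hlower (by positivity)).trans hupper
    _ = 2 := mul_one 2

end SizeBias

section Weights

variable {α : Type*}

/-- The probability of `x` under `P`, as a real number. -/
noncomputable def mass (P : PMF α) (x : α) : ℝ := (P x).toReal

theorem mass_nonneg (P : PMF α) (x : α) : 0 ≤ mass P x := ENNReal.toReal_nonneg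

theorem real_toMeasure_singleton [MeasurableSpace α] [MeasurableSingletonClass α] (P : PMF α)
    (x : α) : P.toMeasure.real {x} = mass P x := by
  rw [measureReal_def, P.toMeasure_apply_singleton x (measurableSet_singleton x), mass]

variable [Fintype α]

theorem sum_mass (P : PMF α) : ∑ x, mass P x = 1 := by
  simp only [mass]
  rw [← ENNReal.toReal_sum fun x _ => P.apply_ne_top x, ← tsum_fintype (L := .unconditional _),
    P.tsum_coe, ENNReal.toReal_one]

theorem integral_toMeasure_eq_sum [MeasurableSpace α] [MeasurableSingletonClass α] (P : PMF α)
    (g : α → ℝ) : ∫ x, g x ∂P.toMeasure = ∑ x, mass P x * g x := by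
  simp only [PMF.integral_eq_sum, smul_eq_mul, mass]

/-- The squared distance of two distributions in the `ℓ²` norm with weights `1 / w`. -/
noncomputable def sqDist (P Q : PMF α) (w : α → ℝ) : ℝ :=
  ∑ x, (mass P x - mass Q x) ^ 2 / w x

/-- The second moment under `P` of the function `(P - Q) / w`, whose mean under `P` exceeds its mean
under `Q` by `sqDist P Q w`. -/
noncomputable def scoreMoment (P Q : PMF α) (w : α → ℝ) : ℝ :=
  ∑ x, mass P x * ((mass P x - mass Q x) / w x) ^ 2

/-- The difference of the means of `f` under `P` and `Q`. -/
noncomputable def gap (P Q : PMF α) (f : α → ℝ) : ℝ := ∑ x, (mass P x - mass Q x) * f x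

/-- The sum of the second moments of `f` under `P` and `Q`. -/
noncomputable def energy (P Q : PMF α) (f : α → ℝ) : ℝ := ∑ x, (mass P x + mass Q x) * f x ^ 2

theorem energy_nonneg (P Q : PMF α) (f : α → ℝ) : 0 ≤ energy P Q f :=
  sum_nonneg fun x _ => mul_nonneg (add_nonneg (mass_nonneg P x) (mass_nonneg Q x)) (sq_nonneg _)

theorem sqDist_nonneg (P Q : PMF α) {w : α → ℝ} (hw : ∀ x, 0 < w x) : 0 ≤ sqDist P Q w :=
  sum_nonneg fun x _ => div_nonneg (sq_nonneg _) (hw x).le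

theorem scoreMoment_nonneg (P Q : PMF α) (w : α → ℝ) : 0 ≤ scoreMoment P Q w :=
  sum_nonneg fun x _ => mul_nonneg (mass_nonneg P x) (sq_nonneg _)

end Weights

section Deviation

variable {α : Type*} [DecidableEq α] {M : ℕ}

/-- The observed frequencies in a vector of samples minus the probabilities under `Q`, each divided
by the weight of the point. -/
noncomputable def deviation (Q : PMF α) (w : α → ℝ) (ω : Fin M → α) (x : α) : ℝ :=
  ((occurrences ω x : ℝ) / M - mass Q x) / w x

theorem integral_deviation_sq_le [Finite α] [MeasurableSpace α] [MeasurableSingletonClass α]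
    (P Q : PMF α) (w : α → ℝ) (hM : 0 < M) (x : α) :
    ∫ ω, deviation Q w ω x ^ 2 ∂Measure.pi (fun _ : Fin M => P.toMeasure) ≤
      (mass P x / M + (mass P x - mass Q x) ^ 2) / w x ^ 2 := by
  have := Fintype.ofFinite α
  simp only [deviation, div_pow, ← empiricalMean_single]
  rw [integral_div]
  gcongr
  refine (integral_empiricalMean_sub_sq_le .of_discrete hM _).trans_eq ?_
  simp only [integral_toMeasure_eq_sum, Pi.single_apply, ite_pow, one_pow, ne_eq,
    OfNat.ofNat_ne_zero, not_false_eq_true, zero_pow, mul_ite, mul_one, mul_zero, sum_ite_eq',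
    mem_univ, if_true]

variable [Fintype α]

theorem gap_deviation_sub_sqDist (P Q : PMF α) (w : α → ℝ) (ω : Fin M → α) :
    gap P Q (deviation Q w ω) - sqDist P Q w =
      empiricalMean (fun x => (mass P x - mass Q x) / w x) ω -
        ∑ x, mass P x * ((mass P x - mass Q x) / w x) := by
  rw [gap, sqDist, empiricalMean,
    sum_comp_eq_sum_occurrences_mul fun x => (mass P x - mass Q x) / w x, sum_div,
    ← sum_sub_distrib, ← sum_sub_distrib]
  refine sum_congr rfl fun x _ => ?_
  rw [deviation]
  ring

variable [MeasurableSpace α] [MeasurableSingletonClass α]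

theorem integral_gap_deviation_sub_sq_le (P Q : PMF α) (w : α → ℝ) (hM : 0 < M) :
    ∫ ω, (gap P Q (deviation Q w ω) - sqDist P Q w) ^ 2
      ∂Measure.pi (fun _ : Fin M => P.toMeasure) ≤ scoreMoment P Q w / M := by
  simp only [gap_deviation_sub_sqDist]
  refine (integral_empiricalMean_sub_sq_le .of_discrete hM _).trans_eq ?_
  rw [integral_toMeasure_eq_sum, integral_toMeasure_eq_sum, sub_self, scoreMoment]
  ring

theorem energy_summand_le {n p q w M : ℝ} (hn : 0 < n) (hM : 0 < M) (hq : 0 ≤ q)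
    (hw : 1 / n ≤ w) (hqw : q ≤ w) :
    (p + q) * ((p / M + (p - q) ^ 2) / w ^ 2) ≤
      p * ((p - q) / w) ^ 2 + (p - q) ^ 2 / w + (4 * (n / M) * ((p - q) ^ 2 / w) + 4 / M) := by
  have hw0 : 0 < w := (by positivity : (0 : ℝ) < 1 / n).trans_le hw
  have hfar : q / w * ((p - q) ^ 2 / w) ≤ (p - q) ^ 2 / w :=
    mul_le_of_le_one_left (by positivity) ((div_le_one hw0).2 hqw)
  have hnoise : (p + q) * p ≤ 4 * (p - q) ^ 2 + 4 * q ^ 2 := by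
    nlinarith [sq_nonneg (p - 2 * q), sq_nonneg (p - q), sq_nonneg (3 * p - 4 * q)]
  have hinv : 1 / w ≤ n := (one_div_le hn hw0).1 hw
  have hratio : (q / w) ^ 2 ≤ 1 := pow_le_one₀ (by positivity) ((div_le_one hw0).2 hqw)
  calc (p + q) * ((p / M + (p - q) ^ 2) / w ^ 2)
    _ = p * ((p - q) / w) ^ 2 + q / w * ((p - q) ^ 2 / w) + (p + q) * p / M / w ^ 2 := by
        field_simp
        ring
    _ ≤ p * ((p - q) / w) ^ 2 + (p - q) ^ 2 / w + (4 * (p - q) ^ 2 + 4 * q ^ 2) / M / w ^ 2 := by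
        gcongr
    _ = p * ((p - q) / w) ^ 2 + (p - q) ^ 2 / w +
          (4 * (1 / w / M) * ((p - q) ^ 2 / w) + 4 * (q / w) ^ 2 / M) := by
        field_simp
    _ ≤ p * ((p - q) / w) ^ 2 + (p - q) ^ 2 / w +
          (4 * (n / M) * ((p - q) ^ 2 / w) + 4 * 1 / M) := by gcongr
    _ = _ := by rw [mul_one]

theorem integral_energy_deviation_le (P Q : PMF α) {w : α → ℝ}
    (hw : ∀ x, 1 / (Fintype.card α : ℝ) ≤ w x) (hqw : ∀ x, mass Q x ≤ w x) (hM : 0 < M) :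
    ∫ ω, energy P Q (deviation Q w ω) ∂Measure.pi (fun _ : Fin M => P.toMeasure) ≤
      scoreMoment P Q w + sqDist P Q w + 4 * (Fintype.card α / M) * (1 + sqDist P Q w) := by
  simp only [energy]
  rw [integral_finsetSum _ fun x _ => .of_finite]
  calc ∑ x, ∫ ω, (mass P x + mass Q x) * deviation Q w ω x ^ 2
        ∂Measure.pi (fun _ : Fin M => P.toMeasure)
    _ ≤ ∑ x, (mass P x + mass Q x) *
          ((mass P x / M + (mass P x - mass Q x) ^ 2) / w x ^ 2) := by
        refine sum_le_sum fun x _ => ?_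
        rw [integral_const_mul]
        exact mul_le_mul_of_nonneg_left (integral_deviation_sq_le P Q w hM x)
          (add_nonneg (mass_nonneg P x) (mass_nonneg Q x))
    _ ≤ ∑ x, (mass P x * ((mass P x - mass Q x) / w x) ^ 2 + (mass P x - mass Q x) ^ 2 / w x +
          (4 * (Fintype.card α / M) * ((mass P x - mass Q x) ^ 2 / w x) + 4 / M)) :=
        sum_le_sum fun x _ => energy_summand_le (by exact_mod_cast Fintype.card_pos_iff.2 ⟨x⟩)
          (by exact_mod_cast hM) (mass_nonneg Q x) (hw x) (hqw x)
    _ = _ := by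
        simp only [sum_add_distrib, ← mul_sum, sum_const, card_univ, nsmul_eq_mul, scoreMoment,
          sqDist]
        ring

end Deviation

section Flatten

variable {α : Type*} [Fintype α] {K : ℕ}

/-- Weights that dominate `Q` and are larger at the points that occur often in a vector of samples.
Adding `1` to the number of occurrences bounds the weights from below. -/
noncomputable def flatten [DecidableEq α] (Q : PMF α) (ω : Fin K → α) (x : α) : ℝ :=
  mass Q x + (occurrences ω x + 1) / Fintype.card α

/-- The expectation of `flatten Q` for `K` samples from `P`. -/
noncomputable def meanFlatten (P Q : PMF α) (K : ℕ) (x : α) : ℝ :=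
  mass Q x + (K * mass P x + 1) / Fintype.card α

theorem meanFlatten_pos (P Q : PMF α) (K : ℕ) (x : α) : 0 < meanFlatten P Q K x :=
  add_pos_of_nonneg_of_pos (mass_nonneg Q x) <|
    div_pos (by have := mass_nonneg P x; positivity) (by exact_mod_cast Fintype.card_pos_iff.2 ⟨x⟩)

theorem sum_meanFlatten (P Q : PMF α) (K : ℕ) :
    ∑ x, meanFlatten P Q K x = 2 + K / Fintype.card α := by
  have : Nonempty α := ⟨P.support_nonempty.some⟩
  simp only [meanFlatten, sum_add_distrib, ← sum_div, ← mul_sum, sum_mass, sum_const, card_univ,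
    nsmul_eq_mul]
  field_simp
  ring

variable [DecidableEq α]

theorem one_div_card_le_flatten (Q : PMF α) (ω : Fin K → α) (x : α) :
    1 / (Fintype.card α : ℝ) ≤ flatten Q ω x :=
  calc 1 / (Fintype.card α : ℝ) ≤ (occurrences ω x + 1) / Fintype.card α := by
        gcongr
        linarith [Nat.cast_nonneg (α := ℝ) (occurrences ω x)]
    _ ≤ flatten Q ω x := le_add_of_nonneg_left (mass_nonneg Q x)

theorem mass_le_flatten (Q : PMF α) (ω : Fin K → α) (x : α) : mass Q x ≤ flatten Q ω x :=
  le_add_of_nonneg_right (by positivity)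

theorem flatten_pos (Q : PMF α) (ω : Fin K → α) (x : α) : 0 < flatten Q ω x :=
  have : Nonempty α := ⟨x⟩
  (by positivity : (0 : ℝ) < 1 / Fintype.card α).trans_le (one_div_card_le_flatten Q ω x)

theorem sq_sqDist_meanFlatten_le (P Q : PMF α) (ω : Fin K → α) :
    sqDist P Q (meanFlatten P Q K) ^ 2 ≤ sqDist P Q (flatten Q ω) *
      ∑ x, ((mass P x - mass Q x) / meanFlatten P Q K x) ^ 2 * flatten Q ω x := by
  have hw := flatten_pos Q ω
  have hmean := meanFlatten_pos P Q K
  refine sum_sq_le_sum_mul_sum_of_sq_le_mul univ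
    (fun x _ => div_nonneg (sq_nonneg _) (hw x).le)
    (fun x _ => mul_nonneg (sq_nonneg _) (hw x).le) fun x _ => le_of_eq ?_
  have := (hw x).ne'
  have := (hmean x).ne'
  field_simp

variable [MeasurableSpace α] [MeasurableSingletonClass α]

theorem integral_flatten (P Q : PMF α) (hK : 0 < K) (x : α) :
    ∫ ω, flatten Q ω x ∂Measure.pi (fun _ : Fin K => P.toMeasure) = meanFlatten P Q K x := by
  have hK' : (K : ℝ) ≠ 0 := by positivity
  have hocc (ω : Fin K → α) : (occurrences ω x : ℝ) = empiricalMean (Pi.single x 1) ω * K := by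
    rw [empiricalMean_single, div_mul_cancel₀ _ hK']
  simp only [flatten, hocc]
  rw [integral_add .of_finite .of_finite, integral_div, integral_add .of_finite .of_finite,
    integral_mul_const, integral_empiricalMean .of_finite hK, integral_toMeasure_eq_sum]
  simp only [Pi.single_apply, mul_ite, mul_one, mul_zero, sum_ite_eq', mem_univ, if_true,
    integral_const, probReal_univ, one_smul, meanFlatten, mul_comm]

theorem add_inv_card_sq_mul_integral_inv_flatten_sq_le (P Q : PMF α) (x : α) :
    (mass Q x + 1 / Fintype.card α) ^ 2 *
      ∫ ω, (flatten Q ω x ^ 2)⁻¹ ∂Measure.pi (fun _ : Fin K => P.toMeasure) ≤ 1 := by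
  have hq := mass_nonneg Q x
  rw [← integral_const_mul]
  calc ∫ ω, (mass Q x + 1 / Fintype.card α) ^ 2 * (flatten Q ω x ^ 2)⁻¹
        ∂Measure.pi (fun _ : Fin K => P.toMeasure)
    _ ≤ ∫ _, (1 : ℝ) ∂Measure.pi (fun _ : Fin K => P.toMeasure) := by
        refine integral_mono .of_finite .of_finite fun ω => ?_
        rw [← div_eq_mul_inv]
        refine div_le_one_of_le₀ ?_ (sq_nonneg _)
        gcongr
        rw [flatten, add_div]
        exact add_le_add_right (le_add_of_nonneg_left (by positivity)) _
    _ = 1 := by rw [integral_const, probReal_univ, one_smul]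

theorem sq_mul_integral_inv_flatten_sq_le (P Q : PMF α) (x : α) :
    (K * mass P x / Fintype.card α) ^ 2 *
      ∫ ω, (flatten Q ω x ^ 2)⁻¹ ∂Measure.pi (fun _ : Fin K => P.toMeasure) ≤ 2 := by
  have : Nonempty α := ⟨x⟩
  have hbound := sq_mul_integral_inv_occurrences_sq_le (M := K) (ν := P.toMeasure) x
  rw [real_toMeasure_singleton] at hbound
  calc (K * mass P x / Fintype.card α) ^ 2 *
        ∫ ω, (flatten Q ω x ^ 2)⁻¹ ∂Measure.pi (fun _ : Fin K => P.toMeasure)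
    _ ≤ (K * mass P x / Fintype.card α) ^ 2 *
        ∫ ω, (Fintype.card α : ℝ) ^ 2 * (((occurrences ω x : ℝ) + 1) ^ 2)⁻¹
          ∂Measure.pi (fun _ : Fin K => P.toMeasure) := by
        refine mul_le_mul_of_nonneg_left (integral_mono .of_finite .of_finite fun ω => ?_)
          (sq_nonneg _)
        beta_reduce
        rw [← div_eq_mul_inv, ← div_pow, ← inv_pow, ← inv_div]
        exact pow_le_pow_left₀ (inv_nonneg.2 (flatten_pos Q ω x).le)
          (inv_anti₀ (by positivity) (le_add_of_nonneg_left (mass_nonneg Q x))) 2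
    _ = (K * mass P x) ^ 2 * ∫ ω, (((occurrences ω x : ℝ) + 1) ^ 2)⁻¹
          ∂Measure.pi (fun _ : Fin K => P.toMeasure) := by
        rw [integral_const_mul]
        field_simp
    _ ≤ 2 := hbound

theorem mass_mul_integral_inv_flatten_sq_le (P Q : PMF α) (hK : 0 < K) (x : α) :
    mass P x * ∫ ω, (flatten Q ω x ^ 2)⁻¹ ∂Measure.pi (fun _ : Fin K => P.toMeasure) ≤
      4 * (Fintype.card α / K) / meanFlatten P Q K x := by
  have : Nonempty α := ⟨x⟩
  have hp := mass_nonneg P x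
  have hq := mass_nonneg Q x
  have hbaseE := add_inv_card_sq_mul_integral_inv_flatten_sq_le (K := K) P Q x
  have hextraE := sq_mul_integral_inv_flatten_sq_le (K := K) P Q x
  set E := ∫ ω, (flatten Q ω x ^ 2)⁻¹ ∂Measure.pi (fun _ : Fin K => P.toMeasure)
  have hE : 0 ≤ E := integral_nonneg fun ω => by positivity
  set base := mass Q x + 1 / (Fintype.card α : ℝ) with hbase
  set extra := K * mass P x / (Fintype.card α : ℝ) with hextra
  have hmean : meanFlatten P Q K x = base + extra := by
    rw [meanFlatten, hbase, hextra]
    ring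
  calc mass P x * E = Fintype.card α / K * (extra * E) := by
        rw [hextra]
        field_simp
    _ ≤ Fintype.card α / K * (4 / (base + extra)) := by
        gcongr
        rw [le_div_iff₀ (by positivity)]
        nlinarith [mul_nonneg (sq_nonneg (base - extra)) hE]
    _ = 4 * (Fintype.card α / K) / meanFlatten P Q K x := by
        rw [hmean]
        ring

theorem integral_sum_sq_mul_flatten (P Q : PMF α) (hK : 0 < K) :
    ∫ ω, ∑ x, ((mass P x - mass Q x) / meanFlatten P Q K x) ^ 2 * flatten Q ω x
      ∂Measure.pi (fun _ : Fin K => P.toMeasure) = sqDist P Q (meanFlatten P Q K) := by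
  rw [integral_finsetSum _ fun x _ => .of_finite]
  refine sum_congr rfl fun x _ => ?_
  have := (meanFlatten_pos P Q K x).ne'
  rw [integral_const_mul, integral_flatten P Q hK]
  field_simp

theorem integral_scoreMoment_flatten_le (P Q : PMF α) (hK : 0 < K) :
    ∫ ω, scoreMoment P Q (flatten Q ω) ∂Measure.pi (fun _ : Fin K => P.toMeasure) ≤
      4 * (Fintype.card α / K) * sqDist P Q (meanFlatten P Q K) := by
  simp only [scoreMoment]
  rw [integral_finsetSum _ fun x _ => .of_finite, sqDist, mul_sum]
  refine sum_le_sum fun x _ => ?_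
  calc ∫ ω, mass P x * ((mass P x - mass Q x) / flatten Q ω x) ^ 2
        ∂Measure.pi (fun _ : Fin K => P.toMeasure)
    _ = (mass P x - mass Q x) ^ 2 * (mass P x *
          ∫ ω, (flatten Q ω x ^ 2)⁻¹ ∂Measure.pi (fun _ : Fin K => P.toMeasure)) := by
        rw [← mul_assoc, ← integral_const_mul]
        congr 1
        funext ω
        rw [div_pow, div_eq_mul_inv]
        ring
    _ ≤ (mass P x - mass Q x) ^ 2 *
          (4 * (Fintype.card α / K) / meanFlatten P Q K x) := by
        gcongr
        exact mass_mul_integral_inv_flatten_sq_le P Q hK x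
    _ = 4 * (Fintype.card α / K) * ((mass P x - mass Q x) ^ 2 / meanFlatten P Q K x) := by ring

end Flatten

section Learn

variable {n : ℕ} {D : Unit → PMF (Fin n)} {P Q : PMF (Fin n)} {ε : ℝ} {M m : ℕ}

/-- Draw `M` samples from the unknown distribution. -/
def samples (M : ℕ) : Proc Unit n (Fin M → Fin n) := (Proc.sample () .ret).replicate M

theorem samples_costLE (M : ℕ) : (samples M : Proc Unit n _).CostLE M :=
  ((Proc.CostLE.sample fun _ => Proc.costLE_ret _).replicate M).mono (by omega)

theorem toMeasure_law_samples (M : ℕ) :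
    ((samples M).law D).toMeasure = Measure.pi fun _ => (D ()).toMeasure := by
  have hsample : (Proc.sample () .ret : Proc Unit n (Fin n)).law D = D () := by
    simp only [Proc.law_sample, Proc.law_ret]
    exact PMF.bind_pure _
  rw [samples, Proc.toMeasure_law_replicate, hsample]

theorem holdsExcept_samples {F : (Fin M → Fin n) → ℝ} {t : ℝ} {δ : ℝ≥0} (hF : 0 ≤ F) (ht : 0 < t)
    (h : ∫ ω, F ω ∂Measure.pi (fun _ => (D ()).toMeasure) ≤ δ * t) :
    HoldsExcept ((samples M).law D) (fun ω => F ω < t) δ :=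
  holdsExcept_lt_of_integral_le hF ht (by rwa [toMeasure_law_samples])

/-- Learn a function on which the unknown distribution and `Q` have different means: the deviation
of the observed frequencies from `Q`, divided by weights that flatten the unknown distribution.
Using only `min M n` samples for the weights keeps their sum bounded. -/
noncomputable def learn (Q : PMF (Fin n)) (M : ℕ) : Proc Unit n (Fin n → ℝ) :=
  (samples (min M n)).bind fun ω => (samples M).bind fun ω' => .ret (deviation Q (flatten Q ω) ω')

theorem learn_costLE (Q : PMF (Fin n)) (M : ℕ) : (learn Q M).CostLE (2 * M) :=
  ((samples_costLE _).bind fun _ => (samples_costLE M).bind_ret _).mono (by omega)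

theorem law_learn (Q : PMF (Fin n)) (M : ℕ) :
    (learn Q M).law D = ((samples (min M n)).law D).bind fun ω =>
      ((samples M).law D).map fun ω' => deviation Q (flatten Q ω) ω' := by
  rw [learn, Proc.law_bind]
  simp only [Proc.law_bind_ret]

theorem sq_le_sqDist_meanFlatten (hε : 0 ≤ ε) (hPQ : ε ≤ tvDist P Q) {K : ℕ} (hK : K ≤ n) :
    ε ^ 2 ≤ sqDist P Q (meanFlatten P Q K) := by
  have hpos := meanFlatten_pos P Q K
  have hsum_pos : 0 < ∑ x, meanFlatten P Q K x :=
    sum_pos (fun x _ => hpos x) ⟨P.support_nonempty.some, mem_univ _⟩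
  have hsum : ∑ x, meanFlatten P Q K x ≤ 3 := by
    have : (K : ℝ) / n ≤ 1 := div_le_one_of_le₀ (by exact_mod_cast hK) n.cast_nonneg
    rw [sum_meanFlatten, Fintype.card_fin]
    linarith
  have htv : 2 * ε ≤ ∑ x, |mass P x - mass Q x| := by
    have : tvDist P Q = (1 / 2) * ∑ x, |mass P x - mass Q x| := rfl
    linarith
  calc ε ^ 2 ≤ (2 * ε) ^ 2 / 3 := by linarith [sq_nonneg ε]
    _ ≤ (∑ x, |mass P x - mass Q x|) ^ 2 / ∑ x, meanFlatten P Q K x := by gcongr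
    _ ≤ ∑ x, |mass P x - mass Q x| ^ 2 / meanFlatten P Q K x :=
        sq_sum_div_le_sum_sq_div _ _ fun x _ => hpos x
    _ = sqDist P Q (meanFlatten P Q K) := by simp only [sq_abs, sqDist]

theorem holdsExcept_flatten {K : ℕ} (hK : 0 < K)
    (hpos : 0 < sqDist (D ()) Q (meanFlatten (D ()) Q K)) :
    HoldsExcept ((samples K).law D) (fun ω =>
      sqDist (D ()) Q (meanFlatten (D ()) Q K) ≤ 120 * sqDist (D ()) Q (flatten Q ω) ∧
      scoreMoment (D ()) Q (flatten Q ω) ≤ 57600 * (n / K) * sqDist (D ()) Q (flatten Q ω))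
      (1 / 60) := by
  set P := D ()
  set β := sqDist P Q (meanFlatten P Q K)
  let Φ (ω : Fin K → Fin n) : ℝ :=
    ∑ x, ((mass P x - mass Q x) / meanFlatten P Q K x) ^ 2 * flatten Q ω x
  let V (ω : Fin K → Fin n) : ℝ := scoreMoment P Q (flatten Q ω)
  have hn : 0 < n := Fin.pos P.support_nonempty.some
  have hΦ (ω : Fin K → Fin n) : 0 ≤ Φ ω :=
    sum_nonneg fun x _ => mul_nonneg (sq_nonneg _) (flatten_pos Q ω x).le
  have hV (ω : Fin K → Fin n) : 0 ≤ V ω / (4 * (n / K)) :=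
    div_nonneg (scoreMoment_nonneg P Q _) (by positivity)
  have hintegral : ∫ ω, (Φ ω + V ω / (4 * (n / K))) ∂Measure.pi (fun _ => P.toMeasure) ≤
      (1 / 60 : ℝ≥0) * (120 * β) := by
    rw [integral_add .of_finite .of_finite, integral_div, integral_sum_sq_mul_flatten P Q hK]
    have hscore := integral_scoreMoment_flatten_le P Q hK
    rw [Fintype.card_fin] at hscore
    have := (div_le_iff₀' (by positivity : (0 : ℝ) < 4 * (n / K))).2 hscore
    push_cast
    linarith
  refine (holdsExcept_samples (fun ω => add_nonneg (hΦ ω) (hV ω)) (by positivity) hintegral).imp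
    fun ω hω => ?_
  have hsqDist : β ≤ 120 * sqDist P Q (flatten Q ω) := by
    refine le_of_mul_le_mul_right ?_ hpos
    calc β * β ≤ sqDist P Q (flatten Q ω) * Φ ω :=
          (sq β).symm.trans_le (sq_sqDist_meanFlatten_le P Q ω)
      _ ≤ sqDist P Q (flatten Q ω) * (120 * β) :=
          mul_le_mul_of_nonneg_left (by linarith [hV ω]) (sqDist_nonneg P Q (flatten_pos Q ω))
      _ = 120 * sqDist P Q (flatten Q ω) * β := by ring
  refine ⟨hsqDist, ?_⟩
  have hVβ : V ω ≤ 120 * β * (4 * (n / K)) :=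
    ((div_lt_iff₀ (by positivity)).1 (by linarith [hΦ ω])).le
  calc V ω ≤ 480 * (n / K) * β := by linarith
    _ ≤ 480 * (n / K) * (120 * sqDist P Q (flatten Q ω)) := by gcongr
    _ = 57600 * (n / K) * sqDist P Q (flatten Q ω) := by ring

theorem holdsExcept_deviation {w : Fin n → ℝ} (hw : ∀ x, 1 / n ≤ w x) (hqw : ∀ x, mass Q x ≤ w x)
    (hM : 0 < M) (hpos : 0 < sqDist (D ()) Q w)
    (hscore : scoreMoment (D ()) Q w / M ≤ 1 / 60 * (sqDist (D ()) Q w ^ 2 / 4)) :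
    HoldsExcept ((samples M).law D) (fun ω =>
      sqDist (D ()) Q w / 2 ≤ gap (D ()) Q (deviation Q w ω) ∧
      energy (D ()) Q (deviation Q w ω) ≤ 60 * (scoreMoment (D ()) Q w + sqDist (D ()) Q w +
        4 * (n / M) * (1 + sqDist (D ()) Q w))) (1 / 60 + 1 / 60) := by
  have hgap : HoldsExcept ((samples M).law D)
      (fun ω => (gap (D ()) Q (deviation Q w ω) - sqDist (D ()) Q w) ^ 2 <
        sqDist (D ()) Q w ^ 2 / 4) (1 / 60) :=
    holdsExcept_samples (fun ω => sq_nonneg _) (by positivity) <|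
      (integral_gap_deviation_sub_sq_le (D ()) Q w hM).trans (by exact_mod_cast hscore)
  have henergy : HoldsExcept ((samples M).law D)
      (fun ω => energy (D ()) Q (deviation Q w ω) < 60 * (scoreMoment (D ()) Q w +
        sqDist (D ()) Q w + 4 * (n / M) * (1 + sqDist (D ()) Q w))) (1 / 60) := by
    have hscore_nonneg := scoreMoment_nonneg (D ()) Q w
    refine holdsExcept_samples (fun ω => energy_nonneg _ _ _) (by positivity) ?_
    have := integral_energy_deviation_le (D ()) Q (by simpa only [Fintype.card_fin] using hw) hqw hM
    rw [Fintype.card_fin] at this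
    push_cast
    linarith
  refine (hgap.and henergy).imp fun ω h => ⟨?_, h.2.le⟩
  have := abs_lt_of_sq_lt_sq (h.1.trans_eq (by ring)) (half_pos hpos).le
  linarith [(abs_lt.1 this).1]

/-- `M` samples suffice to learn a function that `m` samples suffice to test. The constant is large
enough to absorb the losses in all applications of Markov's inequality. -/
structure Enough (n : ℕ) (ε : ℝ) (M m : ℕ) : Prop where
  le : m ≤ M
  test : 10 ^ 14 ≤ m * ε ^ 2
  learn : 10 ^ 14 * (n : ℝ) ≤ M * m * ε ^ 4

theorem Enough.test_pos (h : Enough n ε M m) : 0 < m := by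
  refine Nat.pos_of_ne_zero fun h0 => ?_
  have := h.test
  rw [h0] at this
  norm_num at this

theorem Enough.learn_pos (h : Enough n ε M m) : 0 < M := h.test_pos.trans_le h.le

theorem Enough.div_le (h : Enough n ε M m) : (n : ℝ) / M ≤ m * ε ^ 4 / 10 ^ 14 := by
  have : (0 : ℝ) < M := by exact_mod_cast h.learn_pos
  rw [div_le_div_iff₀ this (by norm_num)]
  linarith [h.learn]

theorem Enough.one_add_div_le (h : Enough n ε M m) (hε : 0 ≤ ε) (hε1 : ε ≤ 1) :
    1 + (n : ℝ) / M ≤ 2 * (m * ε ^ 2) / 10 ^ 14 := by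
  have : (m : ℝ) * ε ^ 4 ≤ m * ε ^ 2 := by
    gcongr ?_ * ?_
    exact pow_le_pow_of_le_one hε hε1 (by norm_num)
  linarith [h.test, h.div_le]

theorem Enough.scoreMoment_div_le (h : Enough n ε M m) (hε : 0 ≤ ε) (hε1 : ε ≤ 1) {a V : ℝ}
    (ha : ε ^ 2 ≤ 120 * a) (hV : V ≤ 57600 * (1 + n / M) * a) :
    V / M ≤ 1 / 60 * (a ^ 2 / 4) := by
  have hM : (0 : ℝ) < M := by exact_mod_cast h.learn_pos
  have ha0 : 0 ≤ a := by linarith [sq_nonneg ε]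
  rw [div_le_iff₀ hM]
  calc V ≤ 57600 * (2 * (m * ε ^ 2) / 10 ^ 14) * a := by
        refine hV.trans ?_
        gcongr
        exact h.one_add_div_le hε hε1
    _ ≤ 57600 * (2 * (M * (120 * a)) / 10 ^ 14) * a := by
        have : (m : ℝ) ≤ M := by exact_mod_cast h.le
        gcongr
    _ ≤ 1 / 60 * (a ^ 2 / 4) * M := by linarith [mul_nonneg (sq_nonneg a) hM.le]

theorem Enough.energy_le (h : Enough n ε M m) (hε : 0 ≤ ε) (hε1 : ε ≤ 1) {a V S : ℝ}
    (ha : ε ^ 2 ≤ 120 * a) (hV : V ≤ 57600 * (1 + n / M) * a)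
    (hS : S ≤ 60 * (V + a + 4 * (n / M) * (1 + a))) : 1024 * S ≤ m * (a / 2) ^ 2 := by
  have ha0 : 0 ≤ a := by linarith [sq_nonneg ε]
  have hm : 0 ≤ m * a ^ 2 := by positivity
  have hratio : (n : ℝ) / M ≤ 14400 * (m * a ^ 2) / 10 ^ 14 := by
    calc (n : ℝ) / M ≤ m * (ε ^ 2) ^ 2 / 10 ^ 14 := h.div_le.trans_eq (by ring)
      _ ≤ m * (120 * a) ^ 2 / 10 ^ 14 := by gcongr
      _ = 14400 * (m * a ^ 2) / 10 ^ 14 := by ring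
  have hscore : (1 + (n : ℝ) / M) * a ≤ 240 * (m * a ^ 2) / 10 ^ 14 := by
    calc (1 + (n : ℝ) / M) * a ≤ 2 * (m * ε ^ 2) / 10 ^ 14 * a := by
          gcongr
          exact h.one_add_div_le hε hε1
      _ ≤ 2 * (m * (120 * a)) / 10 ^ 14 * a := by gcongr
      _ = 240 * (m * a ^ 2) / 10 ^ 14 := by ring
  have : (0 : ℝ) ≤ n / M * a := by positivity
  linarith

theorem div_min_le_one_add_div (hM : 0 < M) (hn : 0 < n) : (n : ℝ) / (min M n : ℕ) ≤ 1 + n / M := by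
  rcases le_total M n with hMn | hMn
  · rw [min_eq_left hMn]
    linarith
  · rw [min_eq_right hMn, div_self (by positivity)]
    exact le_add_of_nonneg_right (by positivity)

theorem learn_far (hε : 0 < ε) (hε1 : ε ≤ 1) (hfar : ε ≤ tvDist (D ()) Q) (h : Enough n ε M m) :
    HoldsExcept ((learn Q M).law D)
      (fun f => ε ^ 2 / 240 ≤ gap (D ()) Q f ∧ 1024 * energy (D ()) Q f ≤ m * gap (D ()) Q f ^ 2)
      (1 / 20) := by
  have hn : 0 < n := Fin.pos Q.support_nonempty.some
  have hM := h.learn_pos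
  have hβ := sq_le_sqDist_meanFlatten hε.le hfar (min_le_right M n)
  have hflatten := holdsExcept_flatten (lt_min hM hn) ((by positivity : 0 < ε ^ 2).trans_le hβ)
  rw [law_learn]
  refine (hflatten.bind (δ' := 1 / 60 + 1 / 60) fun ω _ ⟨hsqDist, hscore⟩ => ?_).mono
    (fun _ _ => id) (by norm_num [← NNReal.coe_le_coe])
  rw [holdsExcept_map_iff]
  set a := sqDist (D ()) Q (flatten Q ω)
  have ha : ε ^ 2 ≤ 120 * a := hβ.trans hsqDist
  have ha0 : 0 < a := by linarith [pow_pos hε 2]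
  have hV : scoreMoment (D ()) Q (flatten Q ω) ≤ 57600 * (1 + n / M) * a :=
    hscore.trans (by gcongr; exact div_min_le_one_add_div hM hn)
  have hw (x : Fin n) := one_div_card_le_flatten Q ω x
  simp only [Fintype.card_fin] at hw
  refine (holdsExcept_deviation hw (mass_le_flatten Q ω) hM ha0
    (h.scoreMoment_div_le hε.le hε1 ha hV)).imp fun ω' ⟨hgap, henergy⟩ => ⟨by linarith, ?_⟩
  calc _ ≤ m * (a / 2) ^ 2 := h.energy_le hε.le hε1 ha hV henergy
    _ ≤ _ := by gcongr

theorem learn_null (hD : D () = Q) (hε : 0 < ε) (h : Enough n ε M m) :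
    HoldsExcept ((learn Q M).law D) (fun f => 10 ^ 10 * energy Q Q f ≤ m * ε ^ 4) (1 / 20) := by
  have hm : (0 : ℝ) < m := by exact_mod_cast h.test_pos
  rw [law_learn, ← zero_add (1 / 20 : ℝ≥0)]
  refine HoldsExcept.bind (p := fun _ => True) (holdsExcept_zero_iff.2 fun _ _ => trivial)
    fun ω _ _ => ?_
  rw [holdsExcept_map_iff]
  have hself (w : Fin n → ℝ) : sqDist Q Q w = 0 ∧ scoreMoment Q Q w = 0 := by
    simp [sqDist, scoreMoment]
  have hmean := integral_energy_deviation_le Q Q (one_div_card_le_flatten Q ω)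
    (mass_le_flatten Q ω) h.learn_pos
  rw [(hself _).1, (hself _).2, Fintype.card_fin] at hmean
  refine (holdsExcept_samples (F := fun ω' => energy Q Q (deviation Q (flatten Q ω) ω'))
    (t := m * ε ^ 4 / 10 ^ 10) (fun ω => energy_nonneg _ _ _) (by positivity) ?_).imp
    fun ω' hω' => ?_
  · rw [hD]
    have := h.div_le
    have : 0 ≤ m * ε ^ 4 := by positivity
    push_cast
    linarith
  · linarith [(lt_div_iff₀ (by norm_num)).1 hω']

end Learn

section Threshold

variable {n m : ℕ} {D : Unit → PMF (Fin n)} {P Q : PMF (Fin n)} {f : Fin n → ℝ} {θ t : ℝ} {δ : ℝ≥0}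

/-- Estimate `gap P Q f` from `m` samples of the unknown distribution `P`. -/
noncomputable def estimate (Q : PMF (Fin n)) (m : ℕ) (f : Fin n → ℝ) : Proc Unit n ℝ :=
  (samples m).bind fun ω => .ret (empiricalMean f ω - ∑ x, mass Q x * f x)

theorem holdsExcept_estimate (hm : 0 < m) (ht : 0 < t)
    (h : ∑ x, mass (D ()) x * f x ^ 2 ≤ δ * (m * t ^ 2)) :
    HoldsExcept ((estimate Q m f).law D) (fun T => |T - gap (D ()) Q f| < t) δ := by
  have hm' : (0 : ℝ) < m := by exact_mod_cast hm
  rw [estimate, Proc.law_bind_ret, holdsExcept_map_iff]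
  have hvar : ∫ ω, (empiricalMean f ω - ∑ x, mass (D ()) x * f x) ^ 2
      ∂Measure.pi (fun _ : Fin m => (D ()).toMeasure) ≤ δ * t ^ 2 := by
    refine (integral_empiricalMean_sub_sq_le .of_discrete hm _).trans ?_
    rw [integral_toMeasure_eq_sum, integral_toMeasure_eq_sum, sub_self, sq 0, mul_zero, add_zero,
      div_le_iff₀ hm']
    linarith
  refine (holdsExcept_samples (fun _ => sq_nonneg _) (by positivity) hvar).imp fun ω hω => ?_
  have hgap : empiricalMean f ω - ∑ x, mass Q x * f x - gap (D ()) Q f =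
      empiricalMean f ω - ∑ x, mass (D ()) x * f x := by
    simp only [gap, sub_mul, sum_sub_distrib]
    ring
  rw [hgap]
  exact abs_lt_of_sq_lt_sq hω ht.le

theorem estimate_costLE (Q : PMF (Fin n)) (m : ℕ) (f : Fin n → ℝ) : (estimate Q m f).CostLE m :=
  (samples_costLE m).bind_ret _

theorem sum_mass_mul_sq_le_energy_left (P Q : PMF (Fin n)) (f : Fin n → ℝ) :
    ∑ x, mass P x * f x ^ 2 ≤ energy P Q f := by
  unfold energy
  gcongr
  exact le_add_of_nonneg_right (mass_nonneg Q _)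

theorem sum_mass_mul_sq_le_energy_right (P Q : PMF (Fin n)) (f : Fin n → ℝ) :
    ∑ x, mass Q x * f x ^ 2 ≤ energy P Q f := by
  unfold energy
  gcongr
  exact le_add_of_nonneg_left (mass_nonneg P _)

/-- Declare the unknown distribution different from `Q` if the estimate of the difference of the
means of `f` exceeds `θ`. -/
noncomputable def thresholdTest (Q : PMF (Fin n)) (m : ℕ) (f : Fin n → ℝ) (θ : ℝ) :
    Proc Unit n Bool :=
  (estimate Q m f).bind fun T => .ret (decide (θ < T))

theorem thresholdTest_costLE (Q : PMF (Fin n)) (m : ℕ) (f : Fin n → ℝ) (θ : ℝ) :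
    (thresholdTest Q m f θ).CostLE m :=
  (estimate_costLE Q m f).bind_ret _

theorem thresholdTest_far (hm : 0 < m) (hθ : θ < gap (D ()) Q f)
    (h : energy (D ()) Q f ≤ δ * (m * (gap (D ()) Q f - θ) ^ 2)) :
    HoldsExcept ((thresholdTest Q m f θ).law D) (· = true) δ := by
  rw [thresholdTest, Proc.law_bind_ret, holdsExcept_map_iff]
  refine (holdsExcept_estimate hm (sub_pos.2 hθ)
    ((sum_mass_mul_sq_le_energy_left _ Q f).trans h)).imp fun T hT => ?_
  exact decide_eq_true (by linarith [(abs_lt.1 hT).1])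

theorem thresholdTest_null (hD : D () = Q) (hm : 0 < m) (hθ : 0 < θ)
    (h : energy P Q f ≤ δ * (m * θ ^ 2)) :
    HoldsExcept ((thresholdTest Q m f θ).law D) (· = false) δ := by
  have hgap : gap Q Q f = 0 := by simp only [gap, sub_self, zero_mul, sum_const_zero]
  rw [thresholdTest, Proc.law_bind_ret, holdsExcept_map_iff]
  refine (holdsExcept_estimate hm hθ ?_).imp fun T hT => ?_
  · rw [hD]
    exact (sum_mass_mul_sq_le_energy_right P Q f).trans h
  · rw [hD, hgap, sub_zero] at hT
    exact decide_eq_false (abs_lt.1 hT).2.not_gt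

end Threshold

section Majority

variable {ι : Type} {n : ℕ} {α : Type} {D : ι → PMF (Fin n)} {δ : ℝ≥0}

theorem holdsExcept_replicate {T : Proc ι n α} {p : α → Prop} [DecidablePred p]
    (h : HoldsExcept (T.law D) p δ) :
    ∀ L j, HoldsExcept ((T.replicate L).law D) (fun v => #{i | ¬ p (v i)} < j) (2 ^ L * δ ^ j)
  | L, 0 => (holdsExcept_one _ _).mono (fun _ _ => id)
      (by rw [pow_zero, mul_one]; exact one_le_pow₀ one_le_two)
  | 0, j + 1 => (holdsExcept_zero_iff.2 fun _ _ => by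
      rw [univ_eq_empty, filter_empty, card_empty]; exact j.succ_pos).mono (fun _ _ => id) zero_le
  | L + 1, j + 1 => by
    have hcount (a : α) (v : Fin L → α) : #{i | ¬ p ((Fin.cons a v : Fin (L + 1) → α) i)} =
        (if p a then 0 else 1) + #{i | ¬ p (v i)} := by
      simp only [Fin.card_filter_univ_succ, Fin.cons_zero, Fin.cons_succ]
      split_ifs <;> omega
    rw [Proc.replicate, Proc.law_bind]
    simp only [Proc.law_bind_ret]
    refine (h.bind_add_mul (δ' := 2 ^ L * δ ^ (j + 1)) (δ'' := 2 ^ L * δ ^ j)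
      (fun a _ ha => ?_) fun a ha => ?_).mono (fun _ _ => id) (le_of_eq (by ring))
    · simpa only [holdsExcept_map_iff, hcount, if_pos ha, zero_add] using
        holdsExcept_replicate h L (j + 1)
    · simpa only [holdsExcept_map_iff, hcount, if_neg ha, add_comm 1,
        Nat.add_lt_add_iff_right] using holdsExcept_replicate h L j

/-- Repeat a test `2 * j` times and return the majority answer. -/
def majority (j : ℕ) (T : Proc ι n Bool) : Proc ι n Bool :=
  (T.replicate (2 * j)).bind fun v => .ret (decide (j < #{i | v i = true}))

theorem majority_costLE {T : Proc ι n Bool} {b : ℕ} (h : T.CostLE b) (j : ℕ) :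
    (majority j T).CostLE (2 * j * b) :=
  (h.replicate _).bind_ret _

theorem decide_lt_card_eq {j : ℕ} {v : Fin (2 * j) → Bool} {b : Bool}
    (h : #{i | ¬ v i = b} < j) : decide (j < #{i | v i = true}) = b := by
  cases b
  · simp only [Bool.not_eq_false] at h
    exact decide_eq_false h.not_gt
  · have := card_filter_add_card_filter_not (s := univ) fun i => v i = true
    rw [card_univ, Fintype.card_fin] at this
    exact decide_eq_true (by omega)

theorem holdsExcept_majority {T : Proc ι n Bool} {b : Bool}
    (h : HoldsExcept (T.law D) (· = b) (1 / 8)) (j : ℕ) :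
    HoldsExcept ((majority j T).law D) (· = b) ((1 / 2) ^ j) := by
  rw [majority, Proc.law_bind_ret, holdsExcept_map_iff]
  refine (holdsExcept_replicate h (2 * j) j).mono (fun v _ => decide_lt_card_eq) ?_
  rw [pow_mul, ← mul_pow]
  norm_num

end Majority

section TestAll

variable {n k : ℕ}

theorem testAll_costLE {T : Proc Unit n Bool} {b : ℕ} (h : T.CostLE b) :
    ∀ L : List (Fin k), (testAll T L).CostLE (L.length * b)
  | [] => (Proc.costLE_ret _).mono (Nat.zero_le _)
  | i :: L => ((h.onArms _).bind fun _ => (testAll_costLE h L).bind_ret _).mono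
      (by rw [List.length_cons, add_one_mul, add_comm])

/-- On every arm, the test tells with error probability at most `δ` whether the arm is in `I`. -/
def Distinguishes (T : Proc Unit n Bool) (D : Fin k → PMF (Fin n)) (I : Finset (Fin k))
    (δ : ℝ≥0) : Prop :=
  ∀ i, HoldsExcept (T.law fun _ => D i) (· = decide (i ∈ I)) δ

theorem holdsExcept_testAll {T : Proc Unit n Bool} {D : Fin k → PMF (Fin n)} {I : Finset (Fin k)}
    {δ : ℝ≥0} (h : Distinguishes T D I δ) :
    ∀ L : List (Fin k), HoldsExcept ((testAll T L).law D) (· = L.filter (· ∈ I)) (L.length * δ)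
  | [] => (holdsExcept_zero_iff.2 fun F hF => by
      rwa [testAll, Proc.law_ret, PMF.mem_support_pure_iff] at hF).mono (fun _ _ => id) zero_le
  | i :: L => by
    rw [testAll, Proc.law_bind, Proc.law_onArms]
    simp only [Proc.law_bind_ret]
    refine ((h i).bind (δ' := L.length * δ) fun b _ hb => ?_).mono (fun _ _ => id)
      (le_of_eq (by push_cast [List.length_cons]; ring))
    rw [holdsExcept_map_iff]
    refine (holdsExcept_testAll h L).imp fun F hF => ?_
    rw [hF, hb, List.filter_cons]

end TestAll

section CostBounds

variable {ι : Type} {n : ℕ} {α β : Type} {D : ι → PMF (Fin n)} {P : Proc ι n α}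
  {f : α → Proc ι n β} {p : α → Prop} {q : β → Prop} {X Y : ℕ} {δ δ' : ℝ≥0}

theorem HoldsExcept.run_of_law (hp : HoldsExcept (P.law D) p δ) (hP : P.CostLE X) :
    HoldsExcept (P.run D) (fun o => p o.1 ∧ o.2 ≤ X) δ :=
  (holdsExcept_map_iff.1 hp).mono (fun o ho h => ⟨h, hP D o ho⟩) le_rfl

theorem HoldsExcept.run_bind (hp : HoldsExcept (P.run D) (fun o => p o.1 ∧ o.2 ≤ X) δ)
    (hf : ∀ a, p a → HoldsExcept ((f a).run D) (fun o => q o.1 ∧ o.2 ≤ Y) δ') :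
    HoldsExcept ((P.bind f).run D) (fun o => q o.1 ∧ o.2 ≤ X + Y) (δ + δ') := by
  rw [Proc.run_bind]
  refine hp.bind fun o _ ho => ?_
  rw [holdsExcept_map_iff]
  exact (hf o.1 ho.1).imp fun o' ho' => ⟨ho'.1, Nat.add_le_add ho.2 ho'.2⟩

theorem holdsExcept_run_ret {a : α} (ha : p a) :
    HoldsExcept ((Proc.ret a : Proc ι n α).run D) (fun o => p o.1 ∧ o.2 ≤ X) δ := by
  refine (holdsExcept_zero_iff.2 fun o ho => ?_).mono (fun _ _ => id) zero_le
  rw [Proc.run, PMF.mem_support_pure_iff] at ho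
  rw [ho]
  exact ⟨ha, X.zero_le⟩

end CostBounds

section UniformSubset

variable {k m : ℕ} {R S I : Finset (Fin k)}

theorem choose_mul_pow_le_choose_mul_pow {a N : ℕ} (haN : a ≤ N) (m : ℕ) :
    a.choose m * N ^ m ≤ N.choose m * a ^ m := by
  have hdesc : a.descFactorial m * N ^ m ≤ N.descFactorial m * a ^ m := by
    induction m with
    | zero => rfl
    | succ m ih =>
      have hstep : (a - m) * N ≤ (N - m) * a := by
        rw [Nat.sub_mul, Nat.sub_mul, mul_comm a N]
        exact Nat.sub_le_sub_left (Nat.mul_le_mul_left m haN) _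
      rw [Nat.descFactorial_succ, Nat.descFactorial_succ, pow_succ, pow_succ]
      calc (a - m) * a.descFactorial m * (N ^ m * N)
        _ = ((a - m) * N) * (a.descFactorial m * N ^ m) := by ring
        _ ≤ ((N - m) * a) * (N.descFactorial m * a ^ m) := Nat.mul_le_mul hstep ih
        _ = (N - m) * N.descFactorial m * (a ^ m * a) := by ring
  rw [Nat.descFactorial_eq_factorial_mul_choose, Nat.descFactorial_eq_factorial_mul_choose,
    mul_assoc, mul_assoc] at hdesc
  exact Nat.le_of_mul_le_mul_left hdesc m.factorial_pos

theorem choose_sub_le_exp_neg_mul_choose {N r : ℕ} (hN : 0 < N) (hrN : r ≤ N) (m : ℕ) :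
    ((N - r).choose m : ℝ) ≤ Real.exp (-(m * r / N)) * N.choose m := by
  have hN' : (0 : ℝ) < N := by exact_mod_cast hN
  have hbase : ((N - r : ℕ) : ℝ) ≤ Real.exp (-(r / N)) * N :=
    calc ((N - r : ℕ) : ℝ)
      _ = (1 - r / N) * N := by rw [Nat.cast_sub hrN]; field_simp
      _ ≤ Real.exp (-(r / N)) * N := by gcongr; exact Real.one_sub_le_exp_neg _
  refine le_of_mul_le_mul_right ?_ (pow_pos hN' m)
  calc ((N - r).choose m : ℝ) * N ^ m
    _ ≤ N.choose m * ((N - r : ℕ) : ℝ) ^ m := by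
        exact_mod_cast choose_mul_pow_le_choose_mul_pow (Nat.sub_le N r) m
    _ ≤ N.choose m * (Real.exp (-(r / N)) * N) ^ m := by gcongr
    _ = Real.exp (-(m * r / N)) * N.choose m * N ^ m := by
        rw [mul_pow, ← Real.exp_nat_mul]
        ring_nf

theorem mem_support_uniformSubset :
    S ∈ (uniformSubset m R).support ↔ S ⊆ R ∧ #S = min m #R := by
  rw [uniformSubset, PMF.mem_support_uniformOfFinset_iff, mem_powersetCard]

theorem card_le_of_mem_support_uniformSubset (h : S ∈ (uniformSubset m R).support) : #S ≤ m :=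
  (mem_support_uniformSubset.1 h).2.trans_le (min_le_left _ _)

theorem ten_mul_card_filter_disjoint_le (hI : I.Nonempty) (hIR : I ⊆ R)
    (h : 9 * #R ≤ m * #I ∨ #R ≤ m) :
    10 * #{S ∈ R.powersetCard (min m #R) | Disjoint S I} ≤ #(R.powersetCard (min m #R)) := by
  have hfilter : {S ∈ R.powersetCard (min m #R) | Disjoint S I} =
      (R \ I).powersetCard (min m #R) := by
    ext S
    rw [mem_filter, mem_powersetCard, mem_powersetCard, subset_sdiff, and_right_comm]
  have hI_pos := hI.card_pos
  have hI_le := card_le_card hIR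
  rw [hfilter, card_powersetCard, card_powersetCard, card_sdiff_of_subset hIR]
  rcases le_or_gt #R m with hm | hm
  · rw [min_eq_right hm, Nat.choose_eq_zero_of_lt (by omega), mul_zero]
    exact Nat.zero_le _
  · have hR : (0 : ℝ) < #R := by exact_mod_cast hI_pos.trans_le hI_le
    have hnine : (9 : ℝ) ≤ m * #I / #R := by
      rw [le_div_iff₀ hR]
      exact_mod_cast h.resolve_right hm.not_ge
    have hexp : 10 * Real.exp (-(m * #I / #R)) ≤ 1 := by
      rw [Real.exp_neg, ← div_eq_mul_inv, div_le_one (Real.exp_pos _)]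
      linarith [Real.add_one_le_exp (m * #I / #R : ℝ)]
    have hchoose := choose_sub_le_exp_neg_mul_choose (hI_pos.trans_le hI_le) hI_le m
    rw [min_eq_left hm.le, ← Nat.cast_le (α := ℝ)]
    push_cast
    nlinarith [((#R).choose m).cast_nonneg (α := ℝ)]

theorem holdsExcept_uniformSubset_not_disjoint (hI : I.Nonempty) (hIR : I ⊆ R)
    (h : 9 * #R ≤ m * #I ∨ #R ≤ m) :
    HoldsExcept (uniformSubset m R) (fun S => ¬ Disjoint S I) (1 / 10) := by
  classical
  simp only [HoldsExcept, not_not]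
  rw [uniformSubset, PMF.toOuterMeasure_uniformOfFinset_apply]
  simp only [Set.mem_ofPred_eq]
  refine ENNReal.div_le_of_le_mul ?_
  have hcount : (#{S ∈ R.powersetCard (min m #R) | Disjoint S I} : ℝ≥0) ≤
      1 / 10 * #(R.powersetCard (min m #R)) := by
    rw [one_div, ← div_eq_inv_mul, le_div_iff₀ (by norm_num), mul_comm]
    exact_mod_cast ten_mul_card_filter_disjoint_le hI hIR h
  exact_mod_cast hcount

end UniformSubset

section FindOne

variable {n k : ℕ} {T : Proc Unit n Bool} {D : Fin k → PMF (Fin n)} {I R : Finset (Fin k)}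
  {b : ℕ} {δ : ℝ≥0}

theorem testAll_sort_costLE (hT : T.CostLE b) {m : ℕ} {S : Finset (Fin k)} (hS : #S ≤ m) :
    (testAll T (S.sort (· ≤ ·))).CostLE (m * b) :=
  (testAll_costLE hT _).mono (Nat.mul_le_mul_right b (by rwa [length_sort]))

theorem findOne_singleton_costLE (hT : T.CostLE b) (m : ℕ) (R : Finset (Fin k)) :
    (findOne [(m, T)] R).CostLE (m * b) := by
  rw [findOne]
  refine Proc.CostLE.random fun S hS => (testAll_sort_costLE hT
    (card_le_of_mem_support_uniformSubset hS)).bind (b' := 0) fun F => ?_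
  cases F <;> exact Proc.costLE_ret _

theorem holdsExcept_findOne_cons {a c : ℝ≥0} {m X : ℕ} {rounds : List (ℕ × Proc Unit n Bool)}
    {p : Finset (Fin k) → Prop} (hT : T.CostLE b) (hδ : Distinguishes T D I δ) (hIR : I ⊆ R)
    (hp : HoldsExcept (uniformSubset m R) p a)
    (hrec : ∀ S, p S → Disjoint S I → ∀ R', I ⊆ R' →
      HoldsExcept ((findOne rounds R').run D) (fun o => (∃ i ∈ I, o.1 = some i) ∧ o.2 ≤ X) c) :
    HoldsExcept ((findOne ((m, T) :: rounds) R).run D)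
      (fun o => (∃ i ∈ I, o.1 = some i) ∧ o.2 ≤ m * b + X) (a + (m * δ + c)) := by
  rw [findOne, Proc.run]
  refine hp.bind fun S hS hpS => ?_
  have hSm := card_le_of_mem_support_uniformSubset hS
  have hlen : (S.sort (· ≤ ·)).length * δ ≤ m * δ := by
    rw [length_sort]
    gcongr
  have htest := ((holdsExcept_testAll hδ (S.sort (· ≤ ·))).mono (fun _ _ => id) hlen).run_of_law
    (testAll_sort_costLE hT hSm)
  refine htest.run_bind (p := (· = (S.sort (· ≤ ·)).filter (· ∈ I)))
    (q := fun o => ∃ i ∈ I, o = some i) fun F hF => ?_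
  have hmem i : i ∈ F ↔ i ∈ S ∧ i ∈ I := by
    rw [hF, List.mem_filter, mem_sort, decide_eq_true_iff]
  rcases F with _ | ⟨i, F⟩
  · have hdisj : Disjoint S I :=
      disjoint_left.2 fun i hiS hiI => List.not_mem_nil ((hmem i).2 ⟨hiS, hiI⟩)
    exact hrec S hpS hdisj _ (subset_sdiff.2 ⟨hIR, hdisj.symm⟩)
  · exact holdsExcept_run_ret (p := fun o => ∃ i ∈ I, o = some i)
      ⟨i, ((hmem i).1 List.mem_cons_self).2, rfl⟩

theorem holdsExcept_findOne {m : ℕ} (hT : T.CostLE b) (hδ : Distinguishes T D I δ)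
    (hI : I.Nonempty) (hm : 9 * k ≤ m * #I ∨ k ≤ m) (post : List (ℕ × Proc Unit n Bool)) :
    ∀ (pre : List ℕ) (R : Finset (Fin k)), I ⊆ R →
      HoldsExcept ((findOne (pre.map (·, T) ++ (m, T) :: post) R).run D)
        (fun o => (∃ i ∈ I, o.1 = some i) ∧ o.2 ≤ (pre.sum + m) * b) ((pre.sum + m) * δ + 1 / 10)
  | [], R, hIR => by
    have hR : #R ≤ k := (card_le_univ R).trans_eq (Fintype.card_fin k)
    have hhit := holdsExcept_uniformSubset_not_disjoint hI hIR
      (hm.imp (Nat.mul_le_mul_left 9 hR).trans hR.trans)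
    have hround := holdsExcept_findOne_cons (X := 0) (c := 0) (rounds := post) hT hδ hIR hhit
      fun S hS hdisj => absurd hdisj hS
    simpa only [List.map_nil, List.nil_append, List.sum_nil, Nat.cast_zero, zero_add, add_zero,
      add_comm] using hround
  | l :: pre, R, hIR => by
    have hround := holdsExcept_findOne_cons (m := l) (p := fun _ => True) hT hδ hIR
      (holdsExcept_zero_iff.2 fun _ _ => trivial)
      fun _ _ _ R' hIR' => holdsExcept_findOne hT hδ hI hm post pre R' hIR'
    rw [List.map_cons, List.cons_append, List.sum_cons, add_assoc l, add_mul l]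
    exact hround.mono (fun _ _ => id) (le_of_eq (by push_cast; ring))

end FindOne

section Stages

variable {n k M m : ℕ} {ε : ℝ} {Q : PMF (Fin n)}

/-- A test with constant error probability for equality to `Q`. Under `Q` the learned function has
gap `0`, and under a distribution that is `ε`-far from `Q` the gap is at least `ε ^ 2 / 240`. -/
noncomputable def basicTest (Q : PMF (Fin n)) (ε : ℝ) (M : ℕ) : Proc Unit n Bool :=
  (learn Q M).bind fun f => thresholdTest Q M f (ε ^ 2 / 480)

theorem basicTest_costLE (Q : PMF (Fin n)) (ε : ℝ) (M : ℕ) : (basicTest Q ε M).CostLE (3 * M) :=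
  ((learn_costLE Q M).bind fun f => thresholdTest_costLE Q M f _).mono (by omega)

theorem basicTest_far {D : Unit → PMF (Fin n)} (hε : 0 < ε) (hε1 : ε ≤ 1)
    (hfar : ε ≤ tvDist (D ()) Q) (h : Enough n ε M M) :
    HoldsExcept ((basicTest Q ε M).law D) (· = true) (1 / 8) := by
  rw [basicTest, Proc.law_bind]
  refine ((learn_far hε hε1 hfar h).bind (δ' := 1 / 16) fun f _ hf => ?_).mono (fun _ _ => id)
    (by norm_num [← NNReal.coe_le_coe])
  obtain ⟨hgap, henergy⟩ := hf
  have hε2 : 0 < ε ^ 2 := by positivity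
  have hsq : (gap (D ()) Q f / 2) ^ 2 ≤ (gap (D ()) Q f - ε ^ 2 / 480) ^ 2 :=
    pow_le_pow_left₀ (by linarith) (by linarith) 2
  refine thresholdTest_far h.test_pos (by linarith) ?_
  calc energy (D ()) Q f
    _ ≤ M * gap (D ()) Q f ^ 2 / 1024 := by linarith
    _ ≤ 1 / 16 * (M * (gap (D ()) Q f / 2) ^ 2) := by nlinarith [sq_nonneg (gap (D ()) Q f)]
    _ ≤ ((1 / 16 : ℝ≥0) : ℝ) * (M * (gap (D ()) Q f - ε ^ 2 / 480) ^ 2) := by push_cast; gcongr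

theorem basicTest_null {D : Unit → PMF (Fin n)} (hD : D () = Q) (hε : 0 < ε)
    (h : Enough n ε M M) : HoldsExcept ((basicTest Q ε M).law D) (· = false) (1 / 8) := by
  rw [basicTest, Proc.law_bind]
  refine ((learn_null hD hε h).bind (δ' := 1 / 16) fun f _ hf => ?_).mono (fun _ _ => id)
    (by norm_num [← NNReal.coe_le_coe])
  refine thresholdTest_null hD h.test_pos (by positivity) (P := Q) ?_
  have hM : 0 ≤ M * ε ^ 4 := by positivity
  push_cast
  linarith

theorem IsInstance.far_known {D : Fin k → PMF (Fin n)} {I : Finset (Fin k)}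
    (hI : IsInstance Q ε D I) {i : Fin k} (hi : i ∈ I) : ε ≤ tvDist (D i) Q := by
  obtain ⟨b, hb⟩ := hI.nonempty_compl
  rw [mem_compl] at hb
  exact hI.known b hb ▸ hI.far i hi b hb

variable {D : Fin k → PMF (Fin n)} {I : Finset (Fin k)} {δ δ' : ℝ≥0}

theorem distinguishes_majority {T : Proc Unit n Bool}
    (hmem : ∀ i ∈ I, HoldsExcept (T.law fun _ => D i) (· = true) (1 / 8))
    (hnot : ∀ i ∉ I, HoldsExcept (T.law fun _ => D i) (· = false) (1 / 8)) (j : ℕ) :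
    Distinguishes (majority j T) D I ((1 / 2) ^ j) := by
  refine fun i => holdsExcept_majority ?_ j
  by_cases hi : i ∈ I
  · simpa only [hi, decide_true] using hmem i hi
  · simpa only [hi, decide_false] using hnot i hi

theorem distinguishes_majority_basicTest (hI : IsInstance Q ε D I) (hε : 0 < ε) (hε1 : ε ≤ 1)
    (h : Enough n ε M M) (j : ℕ) :
    Distinguishes (majority j (basicTest Q ε M)) D I ((1 / 2) ^ j) :=
  distinguishes_majority (fun _ hi => basicTest_far hε hε1 (hI.far_known hi) h)
    (fun i hi => basicTest_null (hI.known i hi) hε h) j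

theorem distinguishes_majority_thresholdTest (hI : IsInstance Q ε D I) {i : Fin k} (hi : i ∈ I)
    {f : Fin n → ℝ} {T : ℝ} (hm : 0 < m) (hgap : 0 < gap (D i) Q f)
    (henergy : 1024 * energy (D i) Q f ≤ m * gap (D i) Q f ^ 2)
    (hT : |T - gap (D i) Q f| < gap (D i) Q f / 4) (j : ℕ) :
    Distinguishes (majority j (thresholdTest Q m f (T / 2))) D I ((1 / 2) ^ j) := by
  obtain ⟨hlower, hupper⟩ := abs_lt.1 hT
  have hmargin (t : ℝ) (ht : 3 / 8 * gap (D i) Q f ≤ t) :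
      energy (D i) Q f ≤ ((1 / 8 : ℝ≥0) : ℝ) * (m * t ^ 2) :=
    calc energy (D i) Q f
      _ ≤ m * gap (D i) Q f ^ 2 / 1024 := by linarith
      _ ≤ 1 / 8 * (m * (3 / 8 * gap (D i) Q f) ^ 2) := by nlinarith [sq_nonneg (gap (D i) Q f)]
      _ ≤ ((1 / 8 : ℝ≥0) : ℝ) * (m * t ^ 2) := by push_cast; gcongr
  refine distinguishes_majority (fun a ha => ?_) (fun b hb => ?_) j
  · rw [hI.same a ha i hi]
    exact thresholdTest_far (D := fun _ => D i) hm (by linarith) (hmargin _ (by linarith))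
  · exact thresholdTest_null (D := fun _ => D b) (P := D i) (hI.known b hb) hm (by linarith)
      (hmargin _ (by linarith))

/-- Classify all arms given the arm `i` as an exemplar. A function is learned from arm `i`, its gap
is estimated from `m` further samples of arm `i`, and then every arm is compared with half this
estimate, by a majority vote of `2 * j` tests with `m` samples each. -/
noncomputable def classifyArms (Q : PMF (Fin n)) (M m j : ℕ) (i : Fin k) :
    Proc (Fin k) n (Finset (Fin k)) :=
  ((learn Q M).onArms fun _ => i).bind fun f =>
    ((estimate Q m f).onArms fun _ => i).bind fun T =>
      (testAll (majority j (thresholdTest Q m f (T / 2))) (List.finRange k)).bind fun F =>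
        .ret F.toFinset

theorem classifyArms_costLE (Q : PMF (Fin n)) (M m j : ℕ) (i : Fin k) :
    (classifyArms Q M m j i).CostLE (2 * M + (m + k * (2 * j * m))) :=
  ((learn_costLE Q M).onArms _).bind fun f => ((estimate_costLE Q m f).onArms _).bind fun T =>
    ((testAll_costLE (majority_costLE (thresholdTest_costLE Q m f (T / 2)) j) _).bind_ret _).mono
      (by rw [List.length_finRange])

theorem holdsExcept_classifyArms (hI : IsInstance Q ε D I) (hε : 0 < ε) (hε1 : ε ≤ 1)
    (h : Enough n ε M m) (j : ℕ) {i : Fin k} (hi : i ∈ I) :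
    HoldsExcept ((classifyArms Q M m j i).law D) (· = I)
      (1 / 20 + (1 / 64 + k * (1 / 2) ^ j)) := by
  rw [classifyArms, Proc.law_bind, Proc.law_onArms]
  refine (learn_far (D := fun _ => D i) hε hε1 (hI.far_known hi) h).bind fun f _ hf => ?_
  obtain ⟨hgap, henergy⟩ := hf
  have hgap_pos : 0 < gap (D i) Q f := (by positivity : 0 < ε ^ 2 / 240).trans_le hgap
  have hmoment : ∑ x, mass (D i) x * f x ^ 2 ≤
      ((1 / 64 : ℝ≥0) : ℝ) * (m * (gap (D i) Q f / 4) ^ 2) := by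
    have := sum_mass_mul_sq_le_energy_left (D i) Q f
    push_cast
    linarith
  rw [Proc.law_bind, Proc.law_onArms]
  refine (holdsExcept_estimate (D := fun _ => D i) h.test_pos (by positivity) hmoment).bind
    fun T _ hT => ?_
  have hall := holdsExcept_testAll
    (distinguishes_majority_thresholdTest hI hi h.test_pos hgap_pos henergy hT j) (List.finRange k)
  rw [List.length_finRange] at hall
  rw [Proc.law_bind_ret, holdsExcept_map_iff]
  refine hall.imp fun F hF => ?_
  rw [hF]
  ext a
  rw [List.mem_toFinset, List.mem_filter, decide_eq_true_iff, and_iff_right (List.mem_finRange a)]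

variable {rounds : List (ℕ × Proc Unit n Bool)} {classify : Fin k → Proc (Fin k) n (Finset (Fin k))}
  {X Y : ℕ}

theorem twoStage_costLE (hfind : (findOne rounds (univ : Finset (Fin k))).CostLE X)
    (hclassify : ∀ i, (classify i).CostLE Y) : (twoStage rounds classify).CostLE (X + Y) := by
  refine hfind.bind fun found => ?_
  cases found with
  | none => exact (Proc.costLE_ret _).mono (Nat.zero_le _)
  | some i => exact hclassify i

theorem holdsExcept_twoStage
    (hfind : HoldsExcept ((findOne rounds univ).run D)
      (fun o => (∃ i ∈ I, o.1 = some i) ∧ o.2 ≤ X) δ)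
    (hcost : ∀ i, (classify i).CostLE Y)
    (hclassify : ∀ i ∈ I, HoldsExcept ((classify i).law D) (· = I) δ') :
    HoldsExcept ((twoStage rounds classify).run D) (fun o => o.1 = I ∧ o.2 ≤ X + Y) (δ + δ') := by
  refine hfind.run_bind (p := fun found => ∃ i ∈ I, found = some i) (q := (· = I)) ?_
  rintro _ ⟨i, hi, rfl⟩
  exact (hclassify i hi).run_of_law (hcost i)

end Stages

section Rounds

variable {n k : ℕ}

theorem exists_roundsUnknownSize_eq_append (T : Proc Unit n Bool) {i : ℕ} (hi : i < k) :
    ∃ post, roundsUnknownSize k (fun _ => T) =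
      ((List.range i).map fun l => 2 ^ (l + 1)).map (·, T) ++ (2 ^ (i + 1), T) :: post := by
  obtain ⟨d, rfl⟩ := Nat.exists_eq_add_of_lt hi
  rw [roundsUnknownSize, add_assoc, List.range_add, List.range_succ_eq_map]
  simp only [List.map_append, List.map_map, List.map_cons, add_zero]
  exact ⟨_, rfl⟩

theorem sum_map_two_pow_range (i : ℕ) :
    ((List.range i).map fun l => 2 ^ (l + 1)).sum + 2 = 2 ^ (i + 1) := by
  induction i with
  | zero => rfl
  | succ i ih =>
    rw [List.range_succ, List.map_append, List.sum_append, List.map_singleton, List.sum_singleton,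
      add_right_comm, ih]
    ring

theorem exists_round_nine_mul_le {r : ℕ} (hrk : r < k) :
    ∃ i < k, (9 * k ≤ 2 ^ (i + 1) * r ∨ k ≤ 2 ^ (i + 1)) ∧ 2 ^ (i + 2) * r ≤ 36 * k := by
  have hlast : 9 * k ≤ 2 ^ (k - 1 + 1) * r ∨ k ≤ 2 ^ (k - 1 + 1) := by
    rw [Nat.sub_add_cancel (by omega)]
    exact Or.inr Nat.lt_two_pow_self.le
  have hex : ∃ i, 9 * k ≤ 2 ^ (i + 1) * r ∨ k ≤ 2 ^ (i + 1) := ⟨k - 1, hlast⟩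
  have hlt : Nat.find hex < k := (Nat.find_min' hex hlast).trans_lt (by omega)
  refine ⟨Nat.find hex, hlt, Nat.find_spec hex, ?_⟩
  rcases hfind : Nat.find hex with _ | i
  · omega
  · have hprev := (not_or.1 (Nat.find_min hex (m := i) (by omega))).1
    have hfour : 2 ^ (i + 1 + 2) * r = 4 * (2 ^ (i + 1) * r) := by ring
    omega

end Rounds

section SampleSizes

variable {n k : ℕ} {ε : ℝ}

/-- Half the number of runs in a majority vote that has to be correct on all arms. -/
noncomputable def repetitions (k : ℕ) : ℕ := ⌈20 * Real.log k⌉₊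

/-- The number of samples from which one test of Stage 1 learns its function; it also evaluates the
function on that many samples. -/
noncomputable def testSize (n : ℕ) (ε : ℝ) : ℕ := ⌈10 ^ 14 * √n / ε ^ 2⌉₊

/-- The order of magnitude of the number of samples drawn in Stage 2. -/
noncomputable def stageTwoSize (n k : ℕ) (ε : ℝ) : ℝ :=
  (k * Real.log k + √(n * k * Real.log k)) / ε ^ 2

/-- The number of samples of the exemplar from which Stage 2 learns its function. -/
noncomputable def exemplarSize (n k : ℕ) (ε : ℝ) : ℕ := ⌈10 ^ 14 * stageTwoSize n k ε⌉₊

/-- The number of samples on which Stage 2 evaluates its function in a single test of an arm. -/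
noncomputable def armSize (n k : ℕ) (ε : ℝ) : ℕ :=
  ⌈10 ^ 14 * (stageTwoSize n k ε / (k * Real.log k))⌉₊

theorem log_two_le_log_natCast (hk : 2 ≤ k) : Real.log 2 ≤ Real.log k :=
  Real.log_le_log two_pos (by exact_mod_cast hk)

theorem one_le_mul_log (hk : 2 ≤ k) : (1 : ℝ) ≤ k * Real.log k := by
  have hk' : (2 : ℝ) ≤ k := by exact_mod_cast hk
  nlinarith [log_two_le_log_natCast hk, Real.log_two_gt_d9]

theorem pow_thirteen_le_two_pow_repetitions (hk : 2 ≤ k) : (k : ℝ) ^ 13 ≤ 2 ^ repetitions k := by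
  have : (0 : ℝ) < k := by exact_mod_cast (by omega : 0 < k)
  rw [← Real.log_le_log_iff (by positivity) (by positivity), Real.log_pow, Real.log_pow]
  have hlog := Real.log_two_gt_d9
  push_cast
  calc 13 * Real.log k
    _ ≤ 20 * Real.log k * Real.log 2 := by nlinarith [log_two_le_log_natCast hk]
    _ ≤ repetitions k * Real.log 2 := by gcongr; exact Nat.le_ceil _

theorem mul_half_pow_repetitions_le (hk : 2 ≤ k) :
    (k : ℝ≥0) * (1 / 2) ^ repetitions k ≤ 1 / 1000 := by
  have hk' : (2 : ℝ) ≤ k := by exact_mod_cast hk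
  have hthousand : 1000 * (k : ℝ) ≤ 2 ^ repetitions k :=
    calc 1000 * (k : ℝ)
      _ ≤ 2 ^ 12 * k := by gcongr; norm_num
      _ ≤ (k : ℝ) ^ 12 * k := by gcongr
      _ ≤ 2 ^ repetitions k := by
          rw [← pow_succ]; exact pow_thirteen_le_two_pow_repetitions hk
  rw [← NNReal.coe_le_coe]
  push_cast
  rw [one_div_pow, mul_one_div, div_le_div_iff₀ (by positivity) (by norm_num)]
  linarith

theorem repetitions_le (hk : 2 ≤ k) : (repetitions k : ℝ) ≤ 22 * Real.log k := by
  have hlog := log_two_le_log_natCast hk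
  have hlog_two := Real.log_two_gt_d9
  have hceil := Nat.ceil_lt_add_one (a := 20 * Real.log k) (by linarith)
  unfold repetitions
  linarith

theorem testSize_le (hn : 0 < n) (hε : 0 < ε) (hε1 : ε ≤ 1) :
    (testSize n ε : ℝ) ≤ 2 * (10 ^ 14 * √n / ε ^ 2) := by
  have hsqrt : (1 : ℝ) ≤ √n := Real.one_le_sqrt.2 (by exact_mod_cast hn)
  have hsq : ε ^ 2 ≤ 1 := pow_le_one₀ hε.le hε1
  refine Nat.ceil_le_two_mul ?_
  rw [le_div_iff₀ (by positivity)]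
  linarith

theorem enough_testSize (hn : 0 < n) (hε : 0 < ε) :
    Enough n ε (testSize n ε) (testSize n ε) := by
  have hsqrt : (1 : ℝ) ≤ √n := Real.one_le_sqrt.2 (by exact_mod_cast hn)
  have hsize : 10 ^ 14 * √n ≤ testSize n ε * ε ^ 2 :=
    (div_le_iff₀ (by positivity)).1 (Nat.le_ceil (10 ^ 14 * √n / ε ^ 2))
  refine ⟨le_rfl, by linarith, ?_⟩
  calc (10 : ℝ) ^ 14 * n
    _ ≤ (10 ^ 14) ^ 2 * n := by gcongr; norm_num
    _ = (10 ^ 14 * √n) ^ 2 := by rw [mul_pow, Real.sq_sqrt n.cast_nonneg]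
    _ ≤ (testSize n ε * ε ^ 2) ^ 2 := by gcongr
    _ = testSize n ε * testSize n ε * ε ^ 4 := by ring

theorem mul_log_le_stageTwoSize (hε : 0 < ε) (hε1 : ε ≤ 1) :
    k * Real.log k ≤ stageTwoSize n k ε := by
  have hL : 0 ≤ k * Real.log k := by positivity
  have hsq : ε ^ 2 ≤ 1 := pow_le_one₀ hε.le hε1
  rw [stageTwoSize, le_div_iff₀ (by positivity)]
  nlinarith [Real.sqrt_nonneg (n * k * Real.log k)]

theorem stageTwoSize_nonneg (n k : ℕ) (ε : ℝ) : 0 ≤ stageTwoSize n k ε := by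
  unfold stageTwoSize
  positivity

theorem natCast_mul_le_stageTwoSize_sq (hε : 0 < ε) :
    n * (k * Real.log k) ≤ stageTwoSize n k ε ^ 2 * ε ^ 4 := by
  have hL : 0 ≤ k * Real.log k := by positivity
  have hB := Real.sq_sqrt (mul_nonneg n.cast_nonneg hL)
  calc n * (k * Real.log k)
    _ = √(n * k * Real.log k) ^ 2 := by rw [mul_assoc (n : ℝ), hB]
    _ ≤ (k * Real.log k + √(n * k * Real.log k)) ^ 2 := by
        gcongr
        exact le_add_of_nonneg_left hL
    _ = stageTwoSize n k ε ^ 2 * ε ^ 4 := by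
        rw [stageTwoSize]
        field_simp

theorem enough_exemplarSize_armSize (hk : 2 ≤ k) (hε : 0 < ε) :
    Enough n ε (exemplarSize n k ε) (armSize n k ε) := by
  have hL := one_le_mul_log hk
  have hL_pos := zero_lt_one.trans_le hL
  have hA := stageTwoSize_nonneg n k ε
  have hexemplar : 10 ^ 14 * stageTwoSize n k ε ≤ exemplarSize n k ε := Nat.le_ceil _
  have harm : 10 ^ 14 * (stageTwoSize n k ε / (k * Real.log k)) ≤ armSize n k ε := Nat.le_ceil _
  refine ⟨?_, ?_, ?_⟩
  · unfold armSize exemplarSize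
    gcongr
    exact div_le_self hA hL
  · calc (10 : ℝ) ^ 14
      _ = 10 ^ 14 * (k * Real.log k / ε ^ 2 / (k * Real.log k)) * ε ^ 2 := by
          rw [div_right_comm, div_self hL_pos.ne']
          field_simp
      _ ≤ 10 ^ 14 * (stageTwoSize n k ε / (k * Real.log k)) * ε ^ 2 := by
          unfold stageTwoSize
          gcongr
          exact le_add_of_nonneg_right (Real.sqrt_nonneg _)
      _ ≤ armSize n k ε * ε ^ 2 := by gcongr
  · calc (10 : ℝ) ^ 14 * n
      _ ≤ (10 ^ 14) ^ 2 * n := by gcongr; norm_num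
      _ ≤ (10 ^ 14) ^ 2 * (stageTwoSize n k ε ^ 2 * ε ^ 4 / (k * Real.log k)) := by
          gcongr
          exact (le_div_iff₀ hL_pos).2 (natCast_mul_le_stageTwoSize_sq hε)
      _ = 10 ^ 14 * stageTwoSize n k ε * (10 ^ 14 * (stageTwoSize n k ε / (k * Real.log k))) *
            ε ^ 4 := by ring
      _ ≤ exemplarSize n k ε * armSize n k ε * ε ^ 4 := by gcongr

end SampleSizes

section Algorithm

variable {n k : ℕ} {ε : ℝ}

/-- The test used in Stage 1. -/
noncomputable def stageOneTest (n k : ℕ) (ε : ℝ) (Q : PMF (Fin n)) : Proc Unit n Bool :=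
  majority (repetitions k) (basicTest Q ε (testSize n ε))

/-- The procedure used in Stage 2. -/
noncomputable def stageTwo (n k : ℕ) (ε : ℝ) (Q : PMF (Fin n)) :
    Fin k → Proc (Fin k) n (Finset (Fin k)) :=
  classifyArms Q (exemplarSize n k ε) (armSize n k ε) (repetitions k)

/-- The number of samples drawn by the two-stage algorithm if Stage 1 tests `t` arms. -/
noncomputable def totalCost (n k : ℕ) (ε : ℝ) (t : ℕ) : ℕ :=
  t * (2 * repetitions k * (3 * testSize n ε)) +
    (2 * exemplarSize n k ε + (armSize n k ε + k * (2 * repetitions k * armSize n k ε)))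

theorem stageOneTest_costLE (n k : ℕ) (ε : ℝ) (Q : PMF (Fin n)) :
    (stageOneTest n k ε Q).CostLE (2 * repetitions k * (3 * testSize n ε)) :=
  majority_costLE (basicTest_costLE Q ε _) _

theorem stageTwo_costLE (n k : ℕ) (ε : ℝ) (Q : PMF (Fin n)) (i : Fin k) :
    (stageTwo n k ε Q i).CostLE
      (2 * exemplarSize n k ε + (armSize n k ε + k * (2 * repetitions k * armSize n k ε))) :=
  classifyArms_costLE Q _ _ _ i

theorem stageOneCost_le (hn : 0 < n) (hk : 2 ≤ k) (hε : 0 < ε) (hε1 : ε ≤ 1) {r t : ℕ}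
    (hr : 0 < r) (ht : t * r ≤ 36 * k) :
    (t : ℝ) * (2 * repetitions k * (3 * testSize n ε)) ≤
      10 ^ 18 * (k * Real.log k * √n / (r * ε ^ 2)) := by
  have hr' : (0 : ℝ) < r := by exact_mod_cast hr
  have ht' : (t : ℝ) ≤ 36 * k / r := (le_div_iff₀ hr').2 (by exact_mod_cast ht)
  calc (t : ℝ) * (2 * repetitions k * (3 * testSize n ε))
    _ ≤ 36 * k / r * (2 * (22 * Real.log k) * (3 * (2 * (10 ^ 14 * √n / ε ^ 2)))) := by
        gcongr
        · exact repetitions_le hk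
        · exact testSize_le hn hε hε1
    _ = 9504 * 10 ^ 14 * (k * Real.log k * √n / (r * ε ^ 2)) := by field_simp; ring
    _ ≤ 10 ^ 18 * (k * Real.log k * √n / (r * ε ^ 2)) := by gcongr; norm_num

theorem stageTwoCost_le (hk : 2 ≤ k) (hε : 0 < ε) (hε1 : ε ≤ 1) :
    2 * (exemplarSize n k ε : ℝ) +
      (armSize n k ε + k * (2 * repetitions k * armSize n k ε)) ≤
        10 ^ 18 * stageTwoSize n k ε := by
  have hL := one_le_mul_log hk
  have hL_pos := zero_lt_one.trans_le hL
  have hLA : k * Real.log k ≤ stageTwoSize n k ε := mul_log_le_stageTwoSize hε hε1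
  have hone : 1 ≤ stageTwoSize n k ε / (k * Real.log k) := (one_le_div hL_pos).2 hLA
  have hexemplar : (exemplarSize n k ε : ℝ) ≤ 2 * (10 ^ 14 * stageTwoSize n k ε) :=
    Nat.ceil_le_two_mul (by linarith)
  have harm : (armSize n k ε : ℝ) ≤ 2 * (10 ^ 14 * (stageTwoSize n k ε / (k * Real.log k))) :=
    Nat.ceil_le_two_mul (by linarith)
  have hdiv : stageTwoSize n k ε / (k * Real.log k) ≤ stageTwoSize n k ε :=
    div_le_self (by linarith) hL
  have harms : (k : ℝ) * (2 * repetitions k * armSize n k ε) ≤ 88 * 10 ^ 14 * stageTwoSize n k ε :=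
    calc (k : ℝ) * (2 * repetitions k * armSize n k ε)
      _ ≤ k * (2 * (22 * Real.log k) *
            (2 * (10 ^ 14 * (stageTwoSize n k ε / (k * Real.log k))))) := by
          gcongr
          exact repetitions_le hk
      _ = 88 * 10 ^ 14 * (stageTwoSize n k ε / (k * Real.log k) * (k * Real.log k)) := by ring
      _ = 88 * 10 ^ 14 * stageTwoSize n k ε := by rw [div_mul_cancel₀ _ hL_pos.ne']
  linarith

/-- The constant in the sample complexity, as a function of the constant in the threshold between
its two regimes. -/
noncomputable def budgetConstant (c : ℝ) : ℝ := 10 ^ 18 * (1 + √c + 1 / √c)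

theorem budgetConstant_pos (c : ℝ) : 0 < budgetConstant c := by
  unfold budgetConstant
  positivity

theorem sqrt_mul_sq_eq_mul_sqrt {c L : ℝ} (hL : 0 ≤ L) : √(c * L * L) = √c * L := by
  rw [mul_assoc, Real.sqrt_mul' _ (mul_self_nonneg L), Real.sqrt_mul_self hL]

theorem add_sqrt_mul_le_of_mul_le {c L N : ℝ} (hc : 0 < c) (hL : 0 ≤ L) (h : c * L ≤ N) :
    L + √(N * L) ≤ (1 + √c + 1 / √c) * √(N * L) := by
  have hcL : √c * L ≤ √(N * L) := by
    rw [← sqrt_mul_sq_eq_mul_sqrt hL]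
    gcongr
  have hL_le : L ≤ 1 / √c * √(N * L) := by
    rw [one_div_mul_eq_div, le_div_iff₀' (Real.sqrt_pos.2 hc)]
    exact hcL
  have hrest : 0 ≤ √c * √(N * L) := by positivity
  linarith

theorem add_sqrt_mul_le_of_le_mul {c L N : ℝ} (hL : 0 ≤ L) (h : N ≤ c * L) :
    L + √(N * L) ≤ (1 + √c + 1 / √c) * L := by
  have hsqrt : √(N * L) ≤ √c * L := by
    rw [← sqrt_mul_sq_eq_mul_sqrt hL]
    gcongr
  have hrest : 0 ≤ 1 / √c * L := by positivity
  linarith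

theorem withinBudget_of_le {c : ℝ} (hc : 0 < c) {r N : ℕ}
    (hN : (N : ℝ) ≤ 10 ^ 18 * (k * Real.log k * √n / (r * ε ^ 2)) +
      10 ^ 18 * stageTwoSize n k ε) :
    WithinBudget c (budgetConstant c) n k r ε N := by
  have hL : 0 ≤ k * Real.log k := by positivity
  have hZ : 0 ≤ k * Real.log k * √n / (r * ε ^ 2) := by positivity
  have hcoef : 1 ≤ 1 + √c + 1 / √c := by
    rw [add_assoc]
    exact le_add_of_nonneg_right (by positivity)
  have hbudget {B : ℝ} (hB : k * Real.log k + √(n * k * Real.log k) ≤ (1 + √c + 1 / √c) * B) :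
      (N : ℝ) ≤ budgetConstant c * (k * Real.log k * √n / (r * ε ^ 2) + B / ε ^ 2) :=
    calc (N : ℝ)
      _ ≤ 10 ^ 18 * (k * Real.log k * √n / (r * ε ^ 2)) +
            10 ^ 18 * ((k * Real.log k + √(n * k * Real.log k)) / ε ^ 2) := hN
      _ ≤ 10 ^ 18 * ((1 + √c + 1 / √c) * (k * Real.log k * √n / (r * ε ^ 2))) +
            10 ^ 18 * ((1 + √c + 1 / √c) * B / ε ^ 2) := by
          gcongr
          exact le_mul_of_one_le_left hZ hcoef
      _ = budgetConstant c * (k * Real.log k * √n / (r * ε ^ 2) + B / ε ^ 2) := by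
          rw [budgetConstant]
          ring
  refine ⟨fun h => hbudget ?_, fun h => hbudget ?_⟩ <;> rw [mul_assoc (n : ℝ)]
  · exact add_sqrt_mul_le_of_mul_le hc hL h
  · exact add_sqrt_mul_le_of_le_mul hL h

theorem withinBudget_of_le_totalCost (hn : 0 < n) (hk : 2 ≤ k) (hε : 0 < ε) (hε1 : ε ≤ 1) {c : ℝ}
    (hc : 0 < c) {r t N : ℕ} (hr : 0 < r) (ht : t * r ≤ 36 * k) (hN : N ≤ totalCost n k ε t) :
    WithinBudget c (budgetConstant c) n k r ε N := by
  refine withinBudget_of_le hc ?_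
  calc (N : ℝ)
    _ ≤ totalCost n k ε t := by exact_mod_cast hN
    _ ≤ _ := by
        rw [totalCost]
        push_cast
        exact add_le_add (stageOneCost_le hn hk hε hε1 hr ht) (stageTwoCost_le hk hε hε1)

variable {Q : PMF (Fin n)} {D : Fin k → PMF (Fin n)} {I : Finset (Fin k)}

theorem IsInstance.card_lt (hI : IsInstance Q ε D I) : #I < k := by
  simpa only [Fintype.card_fin] using
    card_lt_univ_of_notMem (mem_compl.1 hI.nonempty_compl.choose_spec)

theorem IsInstance.two_le (hI : IsInstance Q ε D I) : 2 ≤ k :=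
  (Nat.succ_le_succ hI.nonempty.card_pos).trans hI.card_lt

theorem holdsExcept_twoStage_stageOneTest (hI : IsInstance Q ε D I) (hε : 0 < ε) (hε1 : ε ≤ 1)
    (pre : List ℕ) {m : ℕ} (post : List (ℕ × Proc Unit n Bool))
    (hm : 9 * k ≤ m * #I ∨ k ≤ m) (ht : (pre.sum + m) * #I ≤ 36 * k) :
    HoldsExcept ((twoStage (pre.map (·, stageOneTest n k ε Q) ++ (m, stageOneTest n k ε Q) :: post)
      (stageTwo n k ε Q)).run D) (fun o => o.1 = I ∧ o.2 ≤ totalCost n k ε (pre.sum + m))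
      (1 / 3) := by
  have hn : 0 < n := Fin.pos Q.support_nonempty.some
  have herror := mul_half_pow_repetitions_le hI.two_le
  have htested : ((pre.sum + m : ℕ) : ℝ≥0) ≤ 36 * k := by
    exact_mod_cast (Nat.le_mul_of_pos_right _ hI.nonempty.card_pos).trans ht
  have hfind := holdsExcept_findOne (stageOneTest_costLE n k ε Q)
    (distinguishes_majority_basicTest hI hε hε1 (enough_testSize hn hε) (repetitions k))
    hI.nonempty hm post pre univ (subset_univ I)
  refine (holdsExcept_twoStage hfind (stageTwo_costLE n k ε Q) fun i hi =>
    holdsExcept_classifyArms hI hε hε1 (enough_exemplarSize_armSize hI.two_le hε) _ hi).mono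
    (fun _ _ => id) ?_
  rw [Nat.cast_add] at htested
  calc (pre.sum + m : ℝ≥0) * (1 / 2) ^ repetitions k + 1 / 10 +
        (1 / 20 + (1 / 64 + k * (1 / 2) ^ repetitions k))
    _ ≤ 36 * k * (1 / 2) ^ repetitions k + 1 / 10 +
          (1 / 20 + (1 / 64 + k * (1 / 2) ^ repetitions k)) := by gcongr
    _ = 37 * (k * (1 / 2) ^ repetitions k) + (1 / 10 + (1 / 20 + 1 / 64)) := by ring
    _ ≤ 37 * (1 / 1000) + (1 / 10 + (1 / 20 + 1 / 64)) := by gcongr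
    _ ≤ 1 / 3 := by norm_num [← NNReal.coe_le_coe]

theorem nine_mul_le_ceil_mul {r : ℕ} (hr : 0 < r) (k : ℕ) : 9 * k ≤ ⌈(9 * k : ℝ) / r⌉₊ * r := by
  have hceil := Nat.le_ceil ((9 * k : ℝ) / r)
  rw [div_le_iff₀ (by exact_mod_cast hr)] at hceil
  exact_mod_cast hceil

theorem ceil_nine_mul_div_mul_le {r : ℕ} (hr : 0 < r) (hrk : r ≤ k) :
    ⌈(9 * k : ℝ) / r⌉₊ * r ≤ 36 * k := by
  have hr' : (0 : ℝ) < r := by exact_mod_cast hr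
  have hrk' : (r : ℝ) ≤ k := by exact_mod_cast hrk
  have hceil : (⌈(9 * k : ℝ) / r⌉₊ : ℝ) ≤ 2 * (9 * k / r) :=
    Nat.ceil_le_two_mul (by rw [le_div_iff₀ hr']; linarith)
  have hreal : (⌈(9 * k : ℝ) / r⌉₊ : ℝ) * r ≤ 36 * k :=
    calc (⌈(9 * k : ℝ) / r⌉₊ : ℝ) * r
      _ ≤ 2 * (9 * k / r) * r := by gcongr
      _ = 18 * k := by field_simp; ring
      _ ≤ 36 * k := by gcongr; norm_num
  exact_mod_cast hreal

theorem holdsExcept_twoStage_roundsKnownSize (hI : IsInstance Q ε D I) (hε : 0 < ε) (hε1 : ε ≤ 1) :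
    HoldsExcept ((twoStage (roundsKnownSize k #I (stageOneTest n k ε Q)) (stageTwo n k ε Q)).run D)
      (fun o => o.1 = I) (1 / 3) := by
  have hr := hI.nonempty.card_pos
  refine (holdsExcept_twoStage_stageOneTest hI hε hε1 [] [] (Or.inl (nine_mul_le_ceil_mul hr k))
    ?_).imp fun _ => And.left
  rw [List.sum_nil, zero_add]
  exact ceil_nine_mul_div_mul_le hr hI.card_lt.le

theorem withinBudget_twoStage_roundsKnownSize (hε : 0 < ε) (hε1 : ε ≤ 1) {c : ℝ} (hc : 0 < c)
    {r : ℕ} (hr : 0 < r) (hrk : r < k) {o : Finset (Fin k) × ℕ}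
    (ho : o ∈ ((twoStage (roundsKnownSize k r (stageOneTest n k ε Q))
      (stageTwo n k ε Q)).run D).support) :
    WithinBudget c (budgetConstant c) n k r ε o.2 :=
  withinBudget_of_le_totalCost (Fin.pos Q.support_nonempty.some) (by omega) hε hε1 hc hr
    (ceil_nine_mul_div_mul_le hr hrk.le)
    (twoStage_costLE (findOne_singleton_costLE (stageOneTest_costLE n k ε Q) _ _)
      (stageTwo_costLE n k ε Q) D o ho)

theorem holdsExcept_twoStage_roundsUnknownSize (hI : IsInstance Q ε D I) (hε : 0 < ε)
    (hε1 : ε ≤ 1) {c : ℝ} (hc : 0 < c) :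
    HoldsExcept ((twoStage (roundsUnknownSize k fun _ => stageOneTest n k ε Q)
      (stageTwo n k ε Q)).run D)
      (fun o => o.1 = I ∧ WithinBudget c (budgetConstant c) n k #I ε o.2) (1 / 3) := by
  obtain ⟨i, hik, hhit, hsmall⟩ := exists_round_nine_mul_le hI.card_lt
  obtain ⟨post, hrounds⟩ := exists_roundsUnknownSize_eq_append (stageOneTest n k ε Q) hik
  have htested : ((List.range i).map fun l => 2 ^ (l + 1)).sum + 2 ^ (i + 1) ≤ 2 ^ (i + 2) := by
    have hsum := sum_map_two_pow_range i
    have hpow : 2 ^ (i + 2) = 2 * 2 ^ (i + 1) := pow_succ' 2 (i + 1)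
    omega
  have ht := (Nat.mul_le_mul_right #I htested).trans hsmall
  rw [hrounds]
  exact (holdsExcept_twoStage_stageOneTest hI hε hε1 _ post hhit ht).imp fun o ho => ⟨ho.1,
    withinBudget_of_le_totalCost (Fin.pos Q.support_nonempty.some) hI.two_le hε hε1 hc
      hI.nonempty.card_pos ht ho.2⟩

end Algorithm

end Clustering

/-- The first two conjuncts are about the algorithm that is given the size `r` of the unknown
cluster, the third one is about the variant that is not given `r`. -/
theorem theoremC1 :
    ∃ (tester : (n k r : ℕ) → (ε : ℝ) → (Q : PMF (Fin n)) → Proc Unit n Bool)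
      (roundTester : (n k : ℕ) → (ε : ℝ) → (Q : PMF (Fin n)) → (i : ℕ) → Proc Unit n Bool)
      (classify : (n k : ℕ) → (ε : ℝ) → (Q : PMF (Fin n)) →
        Fin k → Proc (Fin k) n (Finset (Fin k))),
      (∀ (n k : ℕ) (ε : ℝ) (Q : PMF (Fin n)) (D : Fin k → PMF (Fin n)) (I : Finset (Fin k)),
        0 < ε → ε ≤ 1 → IsInstance Q ε D I →
        2 / 3 ≤ ((twoStage (roundsKnownSize k I.card (tester n k I.card ε Q))
          (classify n k ε Q)).run D).toOuterMeasure {o | o.1 = I}) ∧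
      (∀ c : ℝ, 0 < c → ∃ C : ℝ, 0 < C ∧
        ∀ (n k r : ℕ) (ε : ℝ) (Q : PMF (Fin n)) (D : Fin k → PMF (Fin n)),
          0 < ε → ε ≤ 1 → 1 ≤ r → r < k →
          ∀ o ∈ ((twoStage (roundsKnownSize k r (tester n k r ε Q))
            (classify n k ε Q)).run D).support,
            WithinBudget c C n k r ε o.2) ∧
      (∀ c : ℝ, 0 < c → ∃ C : ℝ, 0 < C ∧
        ∀ (n k : ℕ) (ε : ℝ) (Q : PMF (Fin n)) (D : Fin k → PMF (Fin n)) (I : Finset (Fin k)),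
          0 < ε → ε ≤ 1 → IsInstance Q ε D I →
          2 / 3 ≤ ((twoStage (roundsUnknownSize k (roundTester n k ε Q))
            (classify n k ε Q)).run D).toOuterMeasure
              {o | o.1 = I ∧ WithinBudget c C n k I.card ε o.2}) := by
  refine ⟨fun n k _ ε Q => stageOneTest n k ε Q, fun n k ε Q _ => stageOneTest n k ε Q, stageTwo,
    ?known, ?knownBudget, ?unknown⟩
  case known =>
    intro n k ε Q D I hε hε1 hI
    exact (holdsExcept_twoStage_roundsKnownSize hI hε hε1).two_thirds_le
  case knownBudget =>
    refine fun c hc => ⟨budgetConstant c, budgetConstant_pos c, ?_⟩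
    intro n k r ε Q D hε hε1 hr hrk o ho
    exact withinBudget_twoStage_roundsKnownSize hε hε1 hc hr hrk ho
  case unknown =>
    refine fun c hc => ⟨budgetConstant c, budgetConstant_pos c, ?_⟩
    intro n k ε Q D I hε hε1 hI
    exact (holdsExcept_twoStage_roundsUnknownSize hI hε hε1 hc).two_thirds_le
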